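/- Let $\mathcal H$ be a real Hilbert space, let $r\ge 1$ be an integer, let $z\in\mathcal H$, let $A\colon\mathcal H\to 2^{\mathcal H}$ be maximally monotone, and let $C\colon\mathcal H\to\mathcal H$ be monotone and $\mu$-Lipschitzian for some $\mu\in[0,+\infty[$. For every $k\in\{1,\dots,r\}$, let $\mathcal G_k$ and $\mathcal K_k$ be real Hilbert spaces, let $B_k\colon\mathcal G_k\to 2^{\mathcal G_k}$ and $D_k\colon\mathcal K_k\to 2^{\mathcal K_k}$ be maximally monotone, and let $L_k\colon\mathcal H\to\mathcal G_k$ and $M_k\colon\mathcal H\to\mathcal K_k$ be bounded linear operators. For set-valued operators, $A^{-1}$ denotes the inverse ($x\in A^{-1}u\Leftrightarrow u\in Ax$), $J_A=(\mathrm{Id}+A)^{-1}$ the resolvent, $P\,\square\,Q=(P^{-1}+Q^{-1})^{-1}$ the parallel sum, and $T\triangleright P=(T\circ P^{-1}\circ T^*)^{-1}$ the parallel composition of $P$ by a bounded linear operator $T$. Assume that $$\beta=\mu+\sqrt{\sum_{k=1}^r\|L_k\|^2+\max_{1\le k\le r}\big(\|L_k\|^2+\|M_k\|^2\big)}>0$$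 and that the primal inclusion: find $\overline x\in\mathcal H$ such that $$z\in A\overline x+\sum_{k=1}^r\big((L_k^*\circ B_k\circ L_k)\,\square\,(M_k^*\circ D_k\circ M_k)\big)\overline x+C\overline x\qquad\text{(P)}$$ has at least one solution. The dual problem is: find $\overline v_1\in\mathcal G_1,\dots,\overline v_r\in\mathcal G_r$ such that, for every $k\in\{1,\dots,r\}$, $$0\in-L_k\Big((A+C)^{-1}\Big(z-\sum_{l=1}^rL_l^*\overline v_l\Big)\Big)+B_k^{-1}\overline v_k+L_k\Big(\big(M_k^*\triangleright D_k^{-1}\big)(L_k^*\overline v_k)\Big).\qquad\text{(D)}$$ For sequences $(a_n)_{n\in\mathbb N}$ and $(b_n)_{n\in\mathbb N}$ in a Hilbert space, write $a_n\approx b_n$ if $\sum_{n\in\mathbb N}\|a_n-b_n\|<+\infty$. Let $x_0\in\mathcal H$ and, for every $k\in\{1,\dots,r\}$, let $y_{k,0}\in\mathcal H$, $v_{k,0}\in\mathcal G_k$, and $w_{k,0}\in\mathcal K_k$. Let $\varepsilon\in\,]0,1/(\beta+1)[$, let $(\gamma_n)_{n\in\mathbb N}$ be a sequence in $[\varepsilon,(1-\varepsilon)/\beta]$,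 and suppose that, for all $n\in\mathbb N$ and all $k\in\{1,\dots,r\}$, $$\begin{aligned} s_{1,1,n}&\approx x_n-\gamma_n\Big(Cx_n+\sum_{k=1}^rL_k^*v_{k,n}\Big),\\ p_{1,1,n}&\approx J_{\gamma_nA}(s_{1,1,n}+\gamma_nz),\\ p_{1,k+1,n}&\approx y_{k,n}+\gamma_n(L_k^*v_{k,n}-M_k^*w_{k,n}),\\ s_{2,k,n}&\approx v_{k,n}+\gamma_nL_k(x_n-y_{k,n}),\\ p_{2,k,n}&\approx s_{2,k,n}-\gamma_nJ_{\gamma_n^{-1}B_k}(\gamma_n^{-1}s_{2,k,n}),\\ q_{2,k,n}&\approx p_{2,k,n}+\gamma_nL_k(p_{1,1,n}-p_{1,k+1,n}),\\ v_{k,n+1}&=v_{k,n}-s_{2,k,n}+q_{2,k,n},\\ s_{2,k+r,n}&\approx w_{k,n}+\gamma_nM_ky_{k,n},\\ p_{2,k+r,n}&\approx s_{2,k+r,n}-\gamma_nJ_{\gamma_n^{-1}D_k}(\gamma_n^{-1}s_{2,k+r,n}),\\ q_{1,k+1,n}&\approx p_{1,k+1,n}+\gamma_n(L_k^*p_{2,k,n}-M_k^*p_{2,k+r,n}),\\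 q_{2,k+r,n}&\approx p_{2,k+r,n}+\gamma_nM_kp_{1,k+1,n},\\ w_{k,n+1}&=w_{k,n}-s_{2,k+r,n}+q_{2,k+r,n},\\ q_{1,1,n}&\approx p_{1,1,n}-\gamma_n\Big(Cp_{1,1,n}+\sum_{k=1}^rL_k^*p_{2,k,n}\Big),\\ x_{n+1}&=x_n-s_{1,1,n}+q_{1,1,n},\\ y_{k,n+1}&=y_{k,n}-p_{1,k+1,n}+q_{1,k+1,n}. \end{aligned}$$ Then there exist a solution $\overline x$ to (P) and a solution $(\overline v_1,\dots,\overline v_r)$ to (D) such that the following hold. (i) $x_n\rightharpoonup\overline x$ and, for every $k\in\{1,\dots,r\}$, $v_{k,n}\rightharpoonup\overline v_k$. (ii) If $A$ or $C$ is uniformly monotone at $\overline x$, then $x_n\to\overline x$. (iii) If, for some $k\in\{1,\dots,r\}$, $B_k^{-1}$ is uniformly monotone at $\overline v_k$, then $v_{k,n}\to\overline v_k$ for this $k$. Here $\rightharpoonup$ and $\to$ denote weak and strong convergence, and a set-valued operator $T$ is uniformly monotone at $x\in\operatorname{dom}T$ if there is an increasing function $\phi\colon[0,+\infty[\,\to[0,+\infty]$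 vanishing only at $0$ such that $\langle x-y,u-v\rangle\ge\phi(\|x-y\|)$ for all $u\in Tx$, all $y$, and all $v\in Ty$. -/

import Mathlib

open Filter Topology
open scoped NNReal ENNReal InnerProductSpace Pointwise

noncomputable section

namespace MonotoneSplitting

universe u v w

/-! ### Set-valued operators

A set-valued operator from `E` to `F` is a function `E → Set F`; its graph is the set of pairs
`(x, u)` with `u ∈ A x`. Sums, negatives and multiples of sets are Minkowski operations. -/

/-- The inverse `A⁻¹` of a set-valued operator: `x ∈ A⁻¹ u` iff `u ∈ A x`. -/
def opInv {E : Type u} {F : Type v} (A : E → Set F) : F → Set E :=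
  fun y => {x | y ∈ A x}

/-- A function seen as a set-valued operator. -/
def single {E : Type u} {F : Type v} (C : E → F) : E → Set F :=
  fun x => {C x}

/-- The composition `P ∘ B ∘ Q` of a set-valued operator `B` with functions `Q` and `P`,
i.e. `x ↦ P (B (Q x))`, where `P` is applied to a set elementwise. -/
def sandwich {E : Type u} {F : Type v} {F' : Type w} {E' : Type*}
    (P : F' → E') (B : F → Set F') (Q : E → F) : E → Set E' :=
  fun x => P '' B (Q x)

/-- The parallel sum `A □ B = (A⁻¹ + B⁻¹)⁻¹`. -/
def parallelSum {E : Type u} [AddCommGroup E] (A B : E → Set E) : E → Set E :=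
  opInv (fun u => opInv A u + opInv B u)

section Hilbert

variable {E : Type u} [NormedAddCommGroup E] [InnerProductSpace ℝ E]
variable {F : Type v} [NormedAddCommGroup F] [InnerProductSpace ℝ F]

/-- The parallel composition `T ▷ A = (T ∘ A⁻¹ ∘ T*)⁻¹` of `A : E → 2^E` by a bounded linear
operator `T : E → F`. -/
def parallelComp [CompleteSpace E] [CompleteSpace F] (T : E →L[ℝ] F) (A : E → Set E) :
    F → Set F :=
  opInv (sandwich T (opInv A) (ContinuousLinearMap.adjoint T))

/-- The resolvent `J_A = (Id + A)⁻¹`, as a set-valued operator. If `A` is maximally monotone,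
all its values are singletons. -/
def opResolvent (A : E → Set E) : E → Set E :=
  opInv (fun p => {p} + A p)

/-- Monotonicity of a set-valued operator. -/
def IsMonotone (A : E → Set E) : Prop :=
  ∀ x y : E, ∀ u ∈ A x, ∀ v ∈ A y, 0 ≤ ⟪x - y, u - v⟫_ℝ

/-- Maximal monotonicity: maximality among the monotone operators for inclusion of graphs
(the order on `E → Set E` is the pointwise inclusion, i.e. the inclusion of graphs). -/
def IsMaximallyMonotone (A : E → Set E) : Prop :=
  Maximal IsMonotone A

/-- Uniform monotonicity of `A` at a point `x` of its domain, with an increasing modulus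
`φ : [0, +∞[ → [0, +∞]` that vanishes only at `0`. -/
def IsUniformlyMonotoneAt (A : E → Set E) (x : E) : Prop :=
  (A x).Nonempty ∧ ∃ φ : ℝ≥0 → ℝ≥0∞, Monotone φ ∧ (∀ t, φ t = 0 ↔ t = 0) ∧
    ∀ u ∈ A x, ∀ y : E, ∀ v ∈ A y,
      ((φ ‖x - y‖₊ : ℝ≥0∞) : EReal) ≤ ((⟪x - y, u - v⟫_ℝ : ℝ) : EReal)

/-- Weak convergence of a sequence. -/
def TendstoWeakly (x : ℕ → E) (l : E) : Prop :=
  Tendsto (fun n => toWeakSpace ℝ E (x n)) atTop (𝓝 (toWeakSpace ℝ E l))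

/-- `x_n ≈ y_n`: the two sequences agree up to absolutely summable errors. -/
def Approx (x y : ℕ → E) : Prop :=
  Summable fun n => ‖x n - y n‖

/-- `x_n ≈ y_n` where `y_n` is the value of a set-valued expression `S_n`. It is used for
expressions in resolvents of maximally monotone operators, for which `S_n` is a singleton. -/
def ApproxValue (x : ℕ → E) (S : ℕ → Set E) : Prop :=
  ∃ y : ℕ → E, (∀ n, y n ∈ S n) ∧ Approx x y

end Hilbert

/-! ### The primal-dual problem -/

section Problem

variable {r : ℕ} {H : Type u} {G : Fin r → Type v} {K : Fin r → Type w}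
variable [NormedAddCommGroup H] [InnerProductSpace ℝ H] [CompleteSpace H]
variable [∀ k, NormedAddCommGroup (G k)] [∀ k, InnerProductSpace ℝ (G k)]
  [∀ k, CompleteSpace (G k)]
variable [∀ k, NormedAddCommGroup (K k)] [∀ k, InnerProductSpace ℝ (K k)]
  [∀ k, CompleteSpace (K k)]

/-- `β = μ + √(∑ₖ ‖Lₖ‖² + maxₖ (‖Lₖ‖² + ‖Mₖ‖²))`. -/
def beta (μ : ℝ≥0) (L : ∀ k, H →L[ℝ] G k) (M : ∀ k, H →L[ℝ] K k) : ℝ :=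
  (μ : ℝ) + √(∑ k, ‖L k‖ ^ 2 + ⨆ k, (‖L k‖ ^ 2 + ‖M k‖ ^ 2))

/-- `x` solves the primal inclusion
`z ∈ A x + ∑ₖ ((Lₖ* ∘ Bₖ ∘ Lₖ) □ (Mₖ* ∘ Dₖ ∘ Mₖ)) x + C x`. -/
def IsPrimalSolution (z : H) (A : H → Set H) (C : H → H)
    (B : ∀ k, G k → Set (G k)) (D : ∀ k, K k → Set (K k))
    (L : ∀ k, H →L[ℝ] G k) (M : ∀ k, H →L[ℝ] K k) (x : H) : Prop :=
  z ∈ A x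
    + ∑ k, parallelSum
        (sandwich (ContinuousLinearMap.adjoint (L k)) (B k) (L k))
        (sandwich (ContinuousLinearMap.adjoint (M k)) (D k) (M k)) x
    + single C x

/-- `(v₁, …, vᵣ)` solves the dual inclusions
`0 ∈ -Lₖ ((A + C)⁻¹ (z - ∑ₗ Lₗ* vₗ)) + Bₖ⁻¹ vₖ + Lₖ ((Mₖ* ▷ Dₖ⁻¹) (Lₖ* vₖ))`. -/
def IsDualSolution (z : H) (A : H → Set H) (C : H → H)
    (B : ∀ k, G k → Set (G k)) (D : ∀ k, K k → Set (K k))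
    (L : ∀ k, H →L[ℝ] G k) (M : ∀ k, H →L[ℝ] K k) (v : ∀ k, G k) : Prop :=
  ∀ k, (0 : G k) ∈
    -(L k '' opInv (fun x => A x + single C x)
        (z - ∑ l, ContinuousLinearMap.adjoint (L l) (v l)))
    + opInv (B k) (v k)
    + L k '' parallelComp (ContinuousLinearMap.adjoint (M k)) (opInv (D k))
        (ContinuousLinearMap.adjoint (L k) (v k))

end Problem

end MonotoneSplitting

end

noncomputable section

namespace MonotoneSplitting

universe u v w

/-! ### Weak limits along filters -/

section Weak

variable {ι : Type*} {E : Type u} [NormedAddCommGroup E] [InnerProductSpace ℝ E]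

/-! Writing `x = (x - y k) + y k` unfolds each parallel sum: (P) is solvable at `x` iff there are
`y`, `v`, `w` with `v k ∈ B k (L k (x - y k))`, `w k ∈ D k (M k (y k))`, `L k* (v k) = M k* (w k)`
and `z - C x - ∑ k, L k* (v k) ∈ A x`. On the Hilbert sum of the spaces of `(x, y, v, w)` this
system reads `0 ∈ P + Q`. Here `P` (`backwardOp`) is a product of maximally monotone operators, and
`Q` (`forwardOp`) is `C` in the first slot plus a skew operator. Hence `Q` is monotone, and the norm
estimate `norm_coupling_le` makes it `β`-Lipschitz. The `x` and `v` parts of any zero solve (P) and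
(D) (`isPrimalSolution_iff`, `isDualSolution_of_neg_forwardOp_mem`).

The algorithm is the forward-backward-forward method for `P + Q` with summable errors. A step does
not increase the distance to any zero, up to a summable error, and loses a multiple of the squared
distance between the iterate and the resolvent point (`norm_sq_forwardBackwardForward_le`). So these
distances converge, the gap to the resolvent points vanishes, and so do residuals in `P + Q`.
Demiclosedness (`neg_mem_of_weakLim`) puts weak cluster points among the zeros, and Opial's argument
gives weak convergence.

The pairing of the residual with the displacement from the limit also tends to `0`. It is a sum of
nonnegative pairings, one for `C` and one per component of `P`, so each tends to `0`; uniform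
monotonicity of one component then yields strong convergence there. -/

/-- Weak convergence along a filter, tested against inner products. -/
def WeakLim (f : Filter ι) (x : ι → E) (l : E) : Prop :=
  ∀ h : E, Tendsto (fun n => ⟪x n, h⟫_ℝ) f (𝓝 ⟪l, h⟫_ℝ)

theorem tendstoWeakly_of_weakLim [CompleteSpace E] {x : ℕ → E} {l : E}
    (h : WeakLim atTop x l) : TendstoWeakly x l := by
  refine (WeakBilin.tendsto_iff_forall_eval_tendsto (topDualPairing ℝ E).flip ?_).2 ?_
  · intro a b hab
    refine ext_inner_left ℝ fun c => ?_
    exact LinearMap.congr_fun hab (InnerProductSpace.toDual ℝ E c)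
  · intro φ
    have hφ : ∀ a : E, ⟪a, (InnerProductSpace.toDual ℝ E).symm φ⟫_ℝ = φ a := fun a => by
      rw [real_inner_comm, InnerProductSpace.toDual_symm_apply]
    have := h ((InnerProductSpace.toDual ℝ E).symm φ)
    simp only [hφ] at this
    exact this

/-- Banach–Alaoglu transported by the Riesz isometry. Ultrafilters replace subsequences, so no
separability or sequential compactness is needed. -/
theorem exists_ultrafilter_weakLim [CompleteSpace E] (f : Ultrafilter ι) {x : ι → E} {R : ℝ}
    (hx : ∀ n, ‖x n‖ ≤ R) : ∃ l, WeakLim (f : Filter ι) x l := by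
  let g : ι → WeakDual ℝ E := fun n => StrongDual.toWeakDual (InnerProductSpace.toDual ℝ E (x n))
  have hc := WeakDual.isCompact_closedBall (𝕜 := ℝ) (0 : StrongDual ℝ E) R
  obtain ⟨φ, -, hφ⟩ := hc.ultrafilter_le_nhds (f.map g) (by
    rw [Ultrafilter.coe_map, le_principal_iff, mem_map]
    refine Filter.univ_mem' fun n => ?_
    simpa [g] using hx n)
  refine ⟨(InnerProductSpace.toDual ℝ E).symm (WeakDual.toStrongDual φ), fun h => ?_⟩
  have ht : Tendsto g f (𝓝 φ) := hφ
  have := (WeakDual.eval_continuous h).continuousAt.tendsto.comp ht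
  simp only [InnerProductSpace.toDual_symm_apply]
  exact this

theorem exists_ultrafilter_tendsto (f : Ultrafilter ι) {a : ι → ℝ} {R : ℝ}
    (ha : ∀ n, |a n| ≤ R) : ∃ l, Tendsto a f (𝓝 l) := by
  obtain ⟨l, -, hl⟩ := (isCompact_Icc (a := -R) (b := R)).ultrafilter_le_nhds (f.map a) (by
    rw [Ultrafilter.coe_map, le_principal_iff, mem_map]
    exact Filter.univ_mem' fun n => abs_le.1 (ha n))
  exact ⟨l, hl⟩

theorem WeakLim.add_tendsto_zero {f : Filter ι} {x y : ι → E} {l : E} (hx : WeakLim f x l)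
    (hy : Tendsto y f (𝓝 0)) : WeakLim f (fun n => x n + y n) l := by
  intro h
  have := (hx h).add (hy.inner (tendsto_const_nhds (x := h)))
  simpa [inner_add_left] using this

theorem WeakLim.neg {f : Filter ι} {x : ι → E} {l : E} (hx : WeakLim f x l) :
    WeakLim f (fun n => -x n) (-l) := by
  intro h
  simpa [inner_neg_left] using (hx h).neg

theorem WeakLim.map {F : Type v} [NormedAddCommGroup F] [InnerProductSpace ℝ F]
    [CompleteSpace E] [CompleteSpace F] {f : Filter ι} {x : ι → E} {l : E}
    (hx : WeakLim f x l) (T : E →L[ℝ] F) : WeakLim f (fun n => T (x n)) (T l) := by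
  intro h
  simpa [ContinuousLinearMap.adjoint_inner_right] using hx (ContinuousLinearMap.adjoint T h)

theorem tendsto_inner_of_bounded_of_tendsto_zero {f : Filter ι} {x y : ι → E} {R : ℝ}
    (hx : ∀ n, ‖x n‖ ≤ R) (hy : Tendsto y f (𝓝 0)) :
    Tendsto (fun n => ⟪x n, y n⟫_ℝ) f (𝓝 0) := by
  refine squeeze_zero_norm (a := fun n => R * ‖y n‖) (fun n => ?_) ?_
  · exact (norm_inner_le_norm _ _).trans (mul_le_mul_of_nonneg_right (hx n) (norm_nonneg _))
  · simpa using (hy.norm).const_mul R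

/-- Opial's lemma along ultrafilters: a bounded sequence converges weakly to a point of `S` if its
weak limits along ultrafilters belong to `S` and its distance to every point of `S` converges. -/
theorem exists_weakLim_of_opial [CompleteSpace E] {x : ℕ → E} {S : Set E} {R : ℝ}
    (hR : ∀ n, ‖x n‖ ≤ R)
    (hS : ∀ f : Ultrafilter ℕ, (f : Filter ℕ) ≤ atTop → ∀ l, WeakLim (f : Filter ℕ) x l → l ∈ S)
    (hd : ∀ l ∈ S, ∃ d, Tendsto (fun n => ‖x n - l‖) atTop (𝓝 d)) :
    ∃ l ∈ S, WeakLim atTop x l := by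
  have huniq : ∀ f g : Ultrafilter ℕ, (f : Filter ℕ) ≤ atTop → (g : Filter ℕ) ≤ atTop →
      ∀ a b, WeakLim (f : Filter ℕ) x a → WeakLim (g : Filter ℕ) x b → a = b := by
    intro f g hf hg a b ha hb
    obtain ⟨d, hd1⟩ := hd a (hS f hf a ha)
    obtain ⟨e, he1⟩ := hd b (hS g hg b hb)
    -- Convergence of both distances determines the limit of `⟪x n, b - a⟫` along the whole
    -- sequence, so `a` and `b` pair equally with `b - a`.
    have key : Tendsto (fun n => ⟪x n, b - a⟫_ℝ) atTop
        (𝓝 ((d ^ 2 - e ^ 2 - ‖a‖ ^ 2 + ‖b‖ ^ 2) / 2)) := by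
      have := ((((hd1.pow 2).sub (he1.pow 2)).sub_const (‖a‖ ^ 2)).add_const
        (‖b‖ ^ 2)).div_const 2
      refine this.congr fun n => ?_
      rw [norm_sub_sq_real, norm_sub_sq_real, inner_sub_right]
      ring
    have h1 := tendsto_nhds_unique (ha (b - a)) (key.mono_left hf)
    have h2 := tendsto_nhds_unique (hb (b - a)) (key.mono_left hg)
    have h3 : ⟪b - a, b - a⟫_ℝ = 0 := by
      rw [inner_sub_left, h1, h2, sub_self]
    exact (sub_eq_zero.1 (inner_self_eq_zero.1 h3)).symm
  let f₀ : Ultrafilter ℕ := Ultrafilter.of atTop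
  have hf₀ : (f₀ : Filter ℕ) ≤ atTop := Ultrafilter.of_le _
  obtain ⟨l, hl⟩ := exists_ultrafilter_weakLim f₀ hR
  refine ⟨l, hS f₀ hf₀ l hl, fun h => ?_⟩
  refine (tendsto_iff_ultrafilter _ _ _).2 fun g hg => ?_
  obtain ⟨l', hl'⟩ := exists_ultrafilter_weakLim g hR
  rw [huniq f₀ g hf₀ hg l l' hl hl']
  exact hl' h

end Weak

/-! ### Maximally monotone operators -/

section Maximal

variable {E : Type u} [NormedAddCommGroup E] [InnerProductSpace ℝ E]
variable {F : Type v} [NormedAddCommGroup F] [InnerProductSpace ℝ F]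

theorem isMaximallyMonotone_iff {A : E → Set E} :
    IsMaximallyMonotone A ↔ IsMonotone A ∧
      ∀ x u, (∀ y, ∀ w ∈ A y, 0 ≤ ⟪x - y, u - w⟫_ℝ) → u ∈ A x := by
  constructor
  · refine fun hA => ⟨hA.1, fun x u h => ?_⟩
    -- Adjoining the single pair `(x, u)` to the graph keeps it monotone; maximality then absorbs
    -- the pair.
    have hmono : IsMonotone (fun y => A y ∪ {w | y = x ∧ w = u}) := by
      rintro a b c (hc | ⟨rfl, rfl⟩) d (hd | ⟨rfl, rfl⟩)
      · exact hA.1 a b c hc d hd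
      · have := h a c hc
        rw [← neg_sub a b, ← neg_sub c d, inner_neg_neg] at this
        exact this
      · exact h b d hd
      · simp
    exact hA.2 hmono (fun y w hw => Or.inl hw) x (Or.inr ⟨rfl, rfl⟩)
  · rintro ⟨h1, h2⟩
    exact ⟨h1, fun A' hA' hle x u hu => h2 x u fun y w hw => hA' x y u hu w (hle y hw)⟩

theorem IsMaximallyMonotone.isMonotone {A : E → Set E} (hA : IsMaximallyMonotone A) :
    IsMonotone A := hA.1

theorem IsMaximallyMonotone.mem_of_forall {A : E → Set E} (hA : IsMaximallyMonotone A) {x u : E}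
    (h : ∀ y, ∀ w ∈ A y, 0 ≤ ⟪x - y, u - w⟫_ℝ) : u ∈ A x :=
  (isMaximallyMonotone_iff.1 hA).2 x u h

/-- Supplies a test pair in every component of a product: no component contributes positively, so a
strict failure in one cannot be compensated by the others. -/
theorem IsMaximallyMonotone.exists_inner_nonpos {A : E → Set E} (hA : IsMaximallyMonotone A)
    (x u : E) : ∃ y, ∃ w ∈ A y, ⟪x - y, u - w⟫_ℝ ≤ 0 ∧ (u ∉ A x → ⟪x - y, u - w⟫_ℝ < 0) := by
  by_cases hu : u ∈ A x
  · exact ⟨x, u, hu, by simp, fun h => absurd hu h⟩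
  · by_contra! hcon
    refine hu (hA.mem_of_forall fun y w hw => ?_)
    by_contra! hlt
    exact absurd hlt (not_lt.2 (hcon y w hw hlt.le).2)

theorem IsMaximallyMonotone.opInv {A : E → Set E} (hA : IsMaximallyMonotone A) :
    IsMaximallyMonotone (opInv A) := by
  refine isMaximallyMonotone_iff.2 ⟨fun x y u hu v hv => ?_, fun x u h => ?_⟩
  · rw [real_inner_comm]
    exact hA.isMonotone u v x hu y hv
  · refine hA.mem_of_forall (x := u) (u := x) fun y w hw => ?_
    rw [real_inner_comm]
    exact h w y hw

theorem IsMaximallyMonotone.sub_const {A : E → Set E} (hA : IsMaximallyMonotone A) (z : E) :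
    IsMaximallyMonotone (fun x => {u | u + z ∈ A x}) := by
  refine isMaximallyMonotone_iff.2 ⟨fun x y u hu v hv => ?_, fun x u h => ?_⟩
  · simpa using hA.isMonotone x y _ hu _ hv
  · refine hA.mem_of_forall fun y w hw => ?_
    have := h y (w - z) (by simpa using hw)
    rwa [sub_sub_eq_add_sub] at this

/-- Minty's trick: test against the point `x - t • (Q x - u)`, divide by `t`, and let `t` decrease
to `0`; what remains is `0 ≤ -‖Q x - u‖ ^ 2`. -/
theorem isMaximallyMonotone_single {Q : E → E} (hQ : IsMonotone (single Q))
    (hc : Continuous Q) : IsMaximallyMonotone (single Q) := by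
  refine isMaximallyMonotone_iff.2 ⟨hQ, fun x u h => ?_⟩
  have hpos : ∀ t : ℝ, 0 < t → 0 ≤ ⟪Q x - u, u - Q (x - t • (Q x - u))⟫_ℝ := by
    intro t ht
    have := h (x - t • (Q x - u)) _ rfl
    rw [sub_sub_cancel, real_inner_smul_left] at this
    exact nonneg_of_mul_nonneg_right this ht
  have hlim : Tendsto (fun t : ℝ => ⟪Q x - u, u - Q (x - t • (Q x - u))⟫_ℝ) (𝓝[>] 0)
      (𝓝 ⟪Q x - u, u - Q (x - (0 : ℝ) • (Q x - u))⟫_ℝ) := by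
    refine Tendsto.mono_left (Continuous.tendsto ?_ 0) nhdsWithin_le_nhds
    fun_prop
  have hge := ge_of_tendsto hlim (eventually_mem_nhdsWithin.mono fun t ht => hpos t ht)
  rw [zero_smul, sub_zero, ← neg_sub (Q x) u, inner_neg_right, real_inner_self_eq_norm_sq] at hge
  have : ‖Q x - u‖ = 0 := by nlinarith [norm_nonneg (Q x - u)]
  exact (sub_eq_zero.1 (norm_eq_zero.1 this)).symm

/-- The product of two set-valued operators on the Hilbert direct sum. -/
def prodOp (A : E → Set E) (B : F → Set F) : WithLp 2 (E × F) → Set (WithLp 2 (E × F)) :=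
  fun p => {q | q.fst ∈ A p.fst ∧ q.snd ∈ B p.snd}

theorem IsMaximallyMonotone.prodOp {A : E → Set E} {B : F → Set F}
    (hA : IsMaximallyMonotone A) (hB : IsMaximallyMonotone B) :
    IsMaximallyMonotone (prodOp A B) := by
  refine isMaximallyMonotone_iff.2 ⟨fun x y u hu v hv => ?_, fun x u h => ?_⟩
  · exact add_nonneg (hA.isMonotone _ _ _ hu.1 _ hv.1) (hB.isMonotone _ _ _ hu.2 _ hv.2)
  · obtain ⟨y₁, w₁, hw₁, hle₁, hlt₁⟩ := hA.exists_inner_nonpos x.fst u.fst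
    obtain ⟨y₂, w₂, hw₂, hle₂, hlt₂⟩ := hB.exists_inner_nonpos x.snd u.snd
    have hsum : 0 ≤ ⟪x.fst - y₁, u.fst - w₁⟫_ℝ + ⟪x.snd - y₂, u.snd - w₂⟫_ℝ :=
      h (WithLp.toLp 2 (y₁, y₂)) (WithLp.toLp 2 (w₁, w₂)) ⟨hw₁, hw₂⟩
    constructor
    · by_contra hu
      linarith [hlt₁ hu]
    · by_contra hu
      linarith [hlt₂ hu]

/-- The product of a finite family of set-valued operators on the Hilbert direct sum. -/
def piOp {ι : Type*} {E : ι → Type*} (A : ∀ i, E i → Set (E i)) :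
    PiLp 2 E → Set (PiLp 2 E) :=
  fun p => {q | ∀ i, q i ∈ A i (p i)}

theorem IsMaximallyMonotone.piOp {ι : Type*} [Fintype ι] {E : ι → Type*}
    [∀ i, NormedAddCommGroup (E i)] [∀ i, InnerProductSpace ℝ (E i)]
    {A : ∀ i, E i → Set (E i)} (hA : ∀ i, IsMaximallyMonotone (A i)) :
    IsMaximallyMonotone (piOp A) := by
  refine isMaximallyMonotone_iff.2 ⟨fun x y u hu v hv => ?_, fun x u h i => ?_⟩
  · exact Finset.sum_nonneg fun i _ => (hA i).isMonotone _ _ _ (hu i) _ (hv i)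
  · choose y w hw hle hlt using fun i => (hA i).exists_inner_nonpos (x i) (u i)
    have hsum : 0 ≤ ∑ i, ⟪x i - y i, u i - w i⟫_ℝ :=
      h (WithLp.toLp 2 y) (WithLp.toLp 2 w) hw
    by_contra hu
    exact absurd hsum (not_le.2 (Finset.sum_neg' (fun j _ => hle j) ⟨i, Finset.mem_univ i, hlt i hu⟩))

end Maximal

/-! ### Weak-weak closedness -/

section Closed

variable {ι : Type*} {E : Type u} [NormedAddCommGroup E] [InnerProductSpace ℝ E]

theorem tendsto_inner_sub_sub {f : Filter ι} {p w : ι → E} {x u : E} {a : ℝ}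
    (hp : WeakLim f p x) (hw : WeakLim f w u)
    (ha : Tendsto (fun n => ⟪p n, w n⟫_ℝ) f (𝓝 a)) (y t : E) :
    Tendsto (fun n => ⟪p n - y, w n - t⟫_ℝ) f (𝓝 (a - ⟪x, t⟫_ℝ - ⟪u, y⟫_ℝ + ⟪y, t⟫_ℝ)) := by
  refine (((ha.sub (hp t)).sub (hw y)).add_const ⟪y, t⟫_ℝ).congr fun n => ?_
  rw [inner_sub_left, inner_sub_right, inner_sub_right, real_inner_comm y (w n)]
  ring

/-- Pass to the limit in `0 ≤ ⟪p n - p m, w n - w m⟫`, first in `n`, then in `m`, to get `0 ≤ 2 * a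
- 2 * ⟪x, u⟫`. -/
theorem IsMonotone.inner_le_of_weakLim {f : Filter ι} [f.NeBot] {A : E → Set E}
    (hA : IsMonotone A) {p w : ι → E} {x u : E} {a : ℝ}
    (hmem : ∀ n, w n ∈ A (p n)) (hp : WeakLim f p x) (hw : WeakLim f w u)
    (ha : Tendsto (fun n => ⟪p n, w n⟫_ℝ) f (𝓝 a)) : ⟪x, u⟫_ℝ ≤ a := by
  have h1 : ∀ m, 0 ≤ a - ⟪x, w m⟫_ℝ - ⟪u, p m⟫_ℝ + ⟪p m, w m⟫_ℝ := fun m =>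
    ge_of_tendsto' (tendsto_inner_sub_sub hp hw ha (p m) (w m))
      fun n => hA _ _ _ (hmem n) _ (hmem m)
  have h2 : Tendsto (fun m => a - ⟪w m, x⟫_ℝ - ⟪p m, u⟫_ℝ + ⟪p m, w m⟫_ℝ) f
      (𝓝 (a - ⟪u, x⟫_ℝ - ⟪x, u⟫_ℝ + a)) := ((hw x).const_sub a |>.sub (hp u)).add ha
  have h3 := ge_of_tendsto' h2 fun m => by
    rw [real_inner_comm x (w m), real_inner_comm u (p m)]
    exact h1 m
  rw [real_inner_comm x u] at h3
  linarith

theorem IsMaximallyMonotone.mem_of_weakLim {f : Filter ι} [f.NeBot] {A : E → Set E}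
    (hA : IsMaximallyMonotone A) {p w : ι → E} {x u : E}
    (hmem : ∀ n, w n ∈ A (p n)) (hp : WeakLim f p x) (hw : WeakLim f w u)
    (ha : Tendsto (fun n => ⟪p n, w n⟫_ℝ) f (𝓝 ⟪x, u⟫_ℝ)) : u ∈ A x := by
  refine hA.mem_of_forall fun y t ht => ?_
  have := ge_of_tendsto' (tendsto_inner_sub_sub hp hw ha y t)
    fun n => hA.isMonotone _ _ _ (hmem n) _ ht
  rw [inner_sub_left, inner_sub_right, inner_sub_right, real_inner_comm u y]
  linarith

/-- Demiclosedness at `0` of the sum of a maximally monotone operator and a monotone continuous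
operator, along bounded sequences. -/
theorem neg_mem_of_weakLim [CompleteSpace E] (f : Ultrafilter ι) {P : E → Set E} {Q : E → E}
    (hP : IsMaximallyMonotone P) (hQ : IsMonotone (single Q)) (hc : Continuous Q)
    {p u : ι → E} {x : E} {R R' : ℝ} (hpR : ∀ n, ‖p n‖ ≤ R) (hQR : ∀ n, ‖Q (p n)‖ ≤ R')
    (hmem : ∀ n, u n - Q (p n) ∈ P (p n)) (hu : Tendsto u f (𝓝 0))
    (hp : WeakLim (f : Filter ι) p x) : -Q x ∈ P x := by
  obtain ⟨c, hcl⟩ := exists_ultrafilter_weakLim f hQR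
  obtain ⟨a, ha⟩ := exists_ultrafilter_tendsto f (a := fun n => ⟪p n, Q (p n)⟫_ℝ) (R := R * R')
    fun n => (abs_real_inner_le_norm _ _).trans
      (mul_le_mul (hpR n) (hQR n) (norm_nonneg _) ((norm_nonneg _).trans (hpR n)))
  have hw : WeakLim (f : Filter ι) (fun n => u n - Q (p n)) (-c) := by
    simpa only [neg_add_eq_sub] using hcl.neg.add_tendsto_zero hu
  have hwa : Tendsto (fun n => ⟪p n, u n - Q (p n)⟫_ℝ) f (𝓝 (-a)) := by
    have := (tendsto_inner_of_bounded_of_tendsto_zero hpR hu).sub ha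
    simpa only [inner_sub_right, zero_sub] using this
  -- The pairings with `P` and `Q` have opposite limits `-a` and `a`. The two semicontinuity
  -- inequalities therefore force `a = ⟪x, c⟫`, which is what graph closedness requires of each
  -- operator separately.
  have h1 := hP.isMonotone.inner_le_of_weakLim hmem hp hw hwa
  have h2 := hQ.inner_le_of_weakLim (w := fun n => Q (p n)) (fun n => rfl) hp hcl ha
  rw [inner_neg_right] at h1
  obtain rfl : a = ⟪x, c⟫_ℝ := le_antisymm (by linarith) h2
  have h3 : c ∈ single Q x :=
    (isMaximallyMonotone_single hQ hc).mem_of_weakLim (fun n => rfl) hp hcl ha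
  have h4 := hP.mem_of_weakLim hmem hp hw (by rwa [inner_neg_right])
  rwa [show c = Q x from h3] at h4

end Closed

/-! ### The forward-backward-forward iteration -/

/-- Subtracting the partial sums of `e` leaves a decreasing sequence that is bounded below. -/
theorem exists_tendsto_of_le_add {a e : ℕ → ℝ} (ha : ∀ n, 0 ≤ a n) (he : ∀ n, 0 ≤ e n)
    (hs : Summable e) (h : ∀ n, a (n + 1) ≤ a n + e n) : ∃ l, Tendsto a atTop (𝓝 l) := by
  let b : ℕ → ℝ := fun n => a n - ∑ i ∈ Finset.range n, e i
  have hb : Antitone b := antitone_nat_of_succ_le fun n => by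
    simp only [b, Finset.sum_range_succ]
    linarith [h n]
  have hbdd : BddBelow (Set.range b) := by
    refine ⟨-∑' i, e i, ?_⟩
    rintro _ ⟨n, rfl⟩
    have := hs.sum_le_tsum (Finset.range n) fun i _ => he i
    simp only [b]
    linarith [ha n]
  refine ⟨_, ((tendsto_atTop_ciInf hb hbdd).add hs.hasSum.tendsto_sum_nat).congr fun n => ?_⟩
  simp [b]

section ForwardBackwardForward

variable {E : Type u} [NormedAddCommGroup E] [InnerProductSpace ℝ E]

/-- One step of the forward-backward-forward iteration. -/
theorem norm_sq_forwardBackwardForward_le {P : E → Set E} {Q : E → E} (hP : IsMonotone P)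
    (hQ : IsMonotone (single Q)) {β ε g : ℝ} (hL : ∀ a b, ‖Q a - Q b‖ ≤ β * ‖a - b‖)
    (hε : 0 < ε) (hε1 : ε < 1) (hg : 0 < g) (hgβ : g * β ≤ 1 - ε) {z x s p w : E}
    (hz : -Q z ∈ P z) (hw : w ∈ P p) (hs : s = p + g • w) :
    ‖x - s + (p - g • Q p) - z‖ ^ 2 ≤
      ‖x - z‖ ^ 2 - ε * ‖x - p‖ ^ 2 + ‖s - (x - g • Q x)‖ ^ 2 / ε := by
  set t : E := x - s + (p - g • Q p) with ht
  -- Here `x - t = g • (w + Q p)`; inserting `-Q z + Q z = 0` lets monotonicity of `P` and of `Q`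
  -- apply.
  have h1 : 0 ≤ ⟪p - z, x - t⟫_ℝ := by
    have e : x - t = g • ((w - -Q z) + (Q p - Q z)) := by
      rw [ht, hs]; module
    rw [e, real_inner_smul_right, inner_add_right]
    exact mul_nonneg hg.le (add_nonneg (hP _ _ _ hw _ hz) (hQ p z _ rfl _ rfl))
  have h2 : ‖t - z‖ ^ 2 = ‖x - z‖ ^ 2 - ‖x - p‖ ^ 2 + ‖t - p‖ ^ 2 - 2 * ⟪p - z, x - t⟫_ℝ := by
    have e1 : t - z = (t - p) + (p - z) := by abel
    have e2 : x - z = (x - p) + (p - z) := by abel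
    have e3 : x - t = (x - p) - (t - p) := by abel
    rw [e1, e2, e3, norm_add_sq_real, norm_add_sq_real, inner_sub_right (p - z),
      real_inner_comm (p - z) (x - p), real_inner_comm (p - z) (t - p)]
    ring
  have h3 : ‖t - p‖ ≤ (1 - ε) * ‖x - p‖ + ‖s - (x - g • Q x)‖ := by
    have e : t - p = g • (Q x - Q p) - (s - (x - g • Q x)) := by
      rw [ht]; module
    rw [e]
    refine (norm_sub_le _ _).trans (add_le_add_left ?_ _)
    rw [norm_smul, Real.norm_eq_abs, abs_of_pos hg]
    calc g * ‖Q x - Q p‖ ≤ g * (β * ‖x - p‖) := mul_le_mul_of_nonneg_left (hL x p) hg.le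
      _ = g * β * ‖x - p‖ := by ring
      _ ≤ (1 - ε) * ‖x - p‖ := mul_le_mul_of_nonneg_right hgβ (norm_nonneg _)
  -- Convexity of the square for the combination `(1 - ε) * d + ε * (a / ε)`.
  have h4 : ∀ d a : ℝ, ((1 - ε) * d + a) ^ 2 ≤ (1 - ε) * d ^ 2 + a ^ 2 / ε := by
    intro d a
    have : (1 - ε) * d ^ 2 + a ^ 2 / ε - ((1 - ε) * d + a) ^ 2
        = (1 - ε) * (ε * d - a) ^ 2 / ε := by
      field_simp; ring
    have : 0 ≤ (1 - ε) * (ε * d - a) ^ 2 / ε :=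
      div_nonneg (mul_nonneg (by linarith) (sq_nonneg _)) hε.le
    linarith
  have h5 := pow_le_pow_left₀ (norm_nonneg _) h3 2
  have h6 := h4 ‖x - p‖ ‖s - (x - g • Q x)‖
  linarith

/-- Weak convergence of the forward-backward-forward iteration with summable errors. -/
theorem exists_weakLim_forwardBackwardForward [CompleteSpace E] {P : E → Set E} {Q : E → E}
    (hP : IsMaximallyMonotone P) (hQ : IsMonotone (single Q)) {β ε : ℝ} (hβ : 0 < β)
    (hL : ∀ a b, ‖Q a - Q b‖ ≤ β * ‖a - b‖) (hε : 0 < ε) (hε1 : ε < 1) {γ : ℕ → ℝ}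
    (hγ : ∀ n, γ n ∈ Set.Icc ε ((1 - ε) / β)) (hz : ∃ z, -Q z ∈ P z)
    {x s p q b : ℕ → E} (hs : Approx s fun n => x n - γ n • Q (x n)) (hpb : Approx p b)
    (hmem : ∀ n, (γ n)⁻¹ • (s n - b n) ∈ P (b n))
    (hq : Approx q fun n => p n - γ n • Q (p n)) (hx : ∀ n, x (n + 1) = x n - s n + q n) :
    ∃ l, -Q l ∈ P l ∧ WeakLim atTop x l ∧ Tendsto (fun n => x n - b n) atTop (𝓝 0) ∧
      Tendsto (fun n => ⟪b n - l, (γ n)⁻¹ • (s n - b n) + Q l⟫_ℝ) atTop (𝓝 0) ∧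
      Tendsto (fun n => ⟪b n - l, Q (b n) - Q l⟫_ℝ) atTop (𝓝 0) := by
  have hγ0 : ∀ n, 0 < γ n := fun n => hε.trans_le (hγ n).1
  have hγβ : ∀ n, γ n * β ≤ 1 - ε := fun n => (le_div_iff₀ hβ).1 (hγ n).2
  have hc : Continuous Q :=
    (LipschitzWith.of_dist_le_mul (K := ⟨β, hβ.le⟩) fun a c => by
      rw [dist_eq_norm, dist_eq_norm]; exact hL a c).continuous
  let α : ℕ → ℝ := fun n => ‖s n - (x n - γ n • Q (x n))‖
  -- `t n` is the next iterate with the exact resolvent point `b n` in place of `p n` and no error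
  -- in `q n`. The factor `2` in `δ` counts `p n - b n` once directly and once through `γ n • Q`,
  -- which is nonexpansive because `γ n * β ≤ 1`.
  let t : ℕ → E := fun n => x n - s n + (b n - γ n • Q (b n))
  let δ : ℕ → ℝ := fun n => 2 * ‖p n - b n‖ + ‖q n - (p n - γ n • Q (p n))‖
  have hα0 : ∀ n, 0 ≤ α n := fun n => norm_nonneg _
  have hδ0 : ∀ n, 0 ≤ δ n := fun n => by positivity
  have hα : Summable α := hs
  have hδ : Summable δ := (Summable.mul_left 2 hpb).add hq
  have hstep : ∀ z, -Q z ∈ P z → ∀ n,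
      ‖t n - z‖ ^ 2 ≤ ‖x n - z‖ ^ 2 - ε * ‖x n - b n‖ ^ 2 + α n ^ 2 / ε := fun z hz n => by
    refine norm_sq_forwardBackwardForward_le hP.isMonotone hQ hL hε hε1 (hγ0 n) (hγβ n) hz
      (hmem n) ?_
    rw [smul_inv_smul₀ (hγ0 n).ne']
    abel
  have hxt : ∀ n, ‖x (n + 1) - t n‖ ≤ δ n := fun n => by
    have e : x (n + 1) - t n
        = (p n - b n) - γ n • (Q (p n) - Q (b n)) + (q n - (p n - γ n • Q (p n))) := by
      simp only [t, hx n]; module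
    have h1 : ‖γ n • (Q (p n) - Q (b n))‖ ≤ ‖p n - b n‖ := by
      rw [norm_smul, Real.norm_eq_abs, abs_of_pos (hγ0 n)]
      calc γ n * ‖Q (p n) - Q (b n)‖ ≤ γ n * (β * ‖p n - b n‖) :=
            mul_le_mul_of_nonneg_left (hL _ _) (hγ0 n).le
        _ = γ n * β * ‖p n - b n‖ := by ring
        _ ≤ 1 * ‖p n - b n‖ :=
            mul_le_mul_of_nonneg_right ((hγβ n).trans (by linarith)) (norm_nonneg _)
        _ = ‖p n - b n‖ := one_mul _
    rw [e]
    refine (norm_add_le _ _).trans (add_le_add_left ?_ _)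
    refine (norm_sub_le _ _).trans ?_
    linarith
  have hconv : ∀ z, -Q z ∈ P z → ∃ d, Tendsto (fun n => ‖x n - z‖) atTop (𝓝 d) := by
    intro z hz
    refine exists_tendsto_of_le_add (e := fun n => δ n + α n / √ε) (fun n => norm_nonneg _)
      (fun n => add_nonneg (hδ0 n) (div_nonneg (hα0 n) (Real.sqrt_nonneg _)))
      (hδ.add (hα.div_const _)) fun n => ?_
    -- The square of the right side dominates `‖x n - z‖ ^ 2 + α n ^ 2 / ε`, whence the `√ε`.
    have h1 : ‖t n - z‖ ≤ ‖x n - z‖ + α n / √ε := by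
      refine (le_abs_self _).trans (abs_le_of_sq_le_sq ?_ (add_nonneg (norm_nonneg _)
        (div_nonneg (hα0 n) (Real.sqrt_nonneg _))))
      have h2 : (α n / √ε) ^ 2 = α n ^ 2 / ε := by rw [div_pow, Real.sq_sqrt hε.le]
      have h3 : 0 ≤ ‖x n - z‖ * (α n / √ε) :=
        mul_nonneg (norm_nonneg _) (div_nonneg (hα0 n) (Real.sqrt_nonneg _))
      have h4 : 0 ≤ ε * ‖x n - b n‖ ^ 2 := by positivity
      rw [add_sq, h2]
      linarith [hstep z hz n]
    have h2 := norm_sub_le_norm_sub_add_norm_sub (x (n + 1)) (t n) z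
    linarith [hxt n]
  obtain ⟨z, hz⟩ := hz
  obtain ⟨d, hd⟩ := hconv z hz
  have hδ' : Tendsto δ atTop (𝓝 0) := hδ.tendsto_atTop_zero
  have hα' : Tendsto α atTop (𝓝 0) := hα.tendsto_atTop_zero
  have hxb : Tendsto (fun n => x n - b n) atTop (𝓝 0) := by
    have ht : Tendsto (fun n => ‖t n - z‖) atTop (𝓝 d) := by
      have h1 : Tendsto (fun n => ‖x (n + 1) - z‖) atTop (𝓝 d) := (tendsto_add_atTop_iff_nat 1).2 hd
      have h2 : Tendsto (fun n => ‖t n - z‖ - ‖x (n + 1) - z‖) atTop (𝓝 0) := by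
        refine squeeze_zero_norm (fun n => ?_) hδ'
        refine (abs_norm_sub_norm_le _ _).trans ?_
        rw [sub_sub_sub_cancel_right, norm_sub_rev]
        exact hxt n
      simpa using h2.add h1
    have hu : Tendsto (fun n => (‖x n - z‖ ^ 2 - ‖t n - z‖ ^ 2 + α n ^ 2 / ε) / ε) atTop (𝓝 0) := by
      have := (((hd.pow 2).sub (ht.pow 2)).add ((hα'.pow 2).div_const ε)).div_const ε
      simpa using this
    have hsq : Tendsto (fun n => ‖x n - b n‖ ^ 2) atTop (𝓝 0) :=
      squeeze_zero (fun n => by positivity) (fun n => by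
        rw [le_div_iff₀ hε]
        linarith [hstep z hz n]) hu
    refine tendsto_zero_iff_norm_tendsto_zero.2 ?_
    simpa using hsq.sqrt
  have hbx : Tendsto (fun n => b n - x n) atTop (𝓝 0) := by simpa using hxb.neg
  obtain ⟨R, hR⟩ := hd.bddAbove_range
  have hxR : ∀ n, ‖x n‖ ≤ R + ‖z‖ := fun n =>
    (norm_le_norm_sub_add (x n) z).trans (add_le_add_left (hR ⟨n, rfl⟩) _)
  obtain ⟨R', hR'⟩ := hxb.norm.bddAbove_range
  have hbR : ∀ n, ‖b n‖ ≤ R' + (R + ‖z‖) := fun n => by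
    have h1 := norm_le_norm_sub_add (b n) (x n)
    rw [norm_sub_rev] at h1
    have h2 : ‖x n - b n‖ ≤ R' := hR' ⟨n, rfl⟩
    linarith [hxR n]
  have hQR : ∀ n, ‖Q (b n)‖ ≤ β * (R' + (R + ‖z‖)) + ‖Q 0‖ := fun n => by
    have h1 := norm_le_norm_sub_add (Q (b n)) (Q 0)
    have h2 := hL (b n) 0
    rw [sub_zero] at h2
    have h3 := mul_le_mul_of_nonneg_left (hbR n) hβ.le
    linarith
  -- The residual: `u n` belongs to `(P + Q) (b n)`.
  let u : ℕ → E := fun n => (γ n)⁻¹ • (s n - b n) + Q (b n)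
  have hu : Tendsto u atTop (𝓝 0) := by
    refine squeeze_zero_norm (a := fun n => ε⁻¹ * (‖x n - b n‖ + α n) + β * ‖x n - b n‖)
      (fun n => ?_) ?_
    · have e : u n = (γ n)⁻¹ • ((x n - b n) + (s n - (x n - γ n • Q (x n))))
          - (Q (x n) - Q (b n)) := by
        simp only [u, sub_sub_eq_add_sub, smul_sub, smul_add, inv_smul_smul₀ (hγ0 n).ne']
        abel
      rw [e]
      refine (norm_sub_le _ _).trans (add_le_add ?_ (hL _ _))
      rw [norm_smul, norm_inv, Real.norm_eq_abs, abs_of_pos (hγ0 n)]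
      exact mul_le_mul (inv_anti₀ hε (hγ n).1) (norm_add_le _ _) (norm_nonneg _)
        (inv_nonneg.2 hε.le)
    · simpa using ((hxb.norm.add hα').const_mul ε⁻¹).add (hxb.norm.const_mul β)
  obtain ⟨l, hl, hxl⟩ := exists_weakLim_of_opial (S := {l | -Q l ∈ P l}) hxR
    (fun f hf l hfl => by
      refine neg_mem_of_weakLim f hP hQ hc (p := b) (u := u) hbR hQR (fun n => ?_)
        (hu.mono_left hf) ?_
      · simpa [u] using hmem n
      · simpa using hfl.add_tendsto_zero (hbx.mono_left hf)) hconv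
  have hb : ∀ n, ‖b n - l‖ ≤ R' + (R + ‖z‖) + ‖l‖ := fun n =>
    (norm_sub_le _ _).trans (add_le_add_left (hbR n) _)
  have h0 := tendsto_inner_of_bounded_of_tendsto_zero hb hu
  have hsum : ∀ n, ⟪b n - l, u n⟫_ℝ = ⟪b n - l, (γ n)⁻¹ • (s n - b n) + Q l⟫_ℝ
      + ⟪b n - l, Q (b n) - Q l⟫_ℝ := fun n => by
    rw [← inner_add_right]
    congr 1
    simp only [u]
    abel
  have hn1 : ∀ n, 0 ≤ ⟪b n - l, (γ n)⁻¹ • (s n - b n) + Q l⟫_ℝ := fun n => by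
    simpa using hP.isMonotone _ _ _ (hmem n) _ hl
  have hn2 : ∀ n, 0 ≤ ⟪b n - l, Q (b n) - Q l⟫_ℝ := fun n => hQ _ _ _ rfl _ rfl
  refine ⟨l, hl, hxl, hxb, squeeze_zero hn1 (fun n => ?_) h0, squeeze_zero hn2 (fun n => ?_) h0⟩
  · linarith [hsum n, hn2 n]
  · linarith [hsum n, hn1 n]

/-- If `x - p` tends to `0` and the pairings of `p` with `A` at a point of uniform monotonicity
tend to `0`, then `x` converges strongly. -/
theorem IsUniformlyMonotoneAt.tendsto {A : E → Set E} {l u : E} (h : IsUniformlyMonotoneAt A l)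
    (hu : u ∈ A l) {x b w : ℕ → E} (hw : ∀ n, w n ∈ A (b n))
    (hi : Tendsto (fun n => ⟪b n - l, w n - u⟫_ℝ) atTop (𝓝 0))
    (hxb : Tendsto (fun n => x n - b n) atTop (𝓝 0)) : Tendsto x atTop (𝓝 l) := by
  obtain ⟨-, φ, hφ, hφ0, hle⟩ := h
  have hb : Tendsto (fun n => b n - l) atTop (𝓝 0) := by
    refine Metric.tendsto_nhds.2 fun ρ hρ => ?_
    let ρ' : ℝ≥0 := ⟨ρ, hρ.le⟩
    have hpos : 0 < φ ρ' := pos_iff_ne_zero.2 fun h0 => by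
      have := congrArg NNReal.toReal ((hφ0 ρ').1 h0)
      exact hρ.ne' this
    -- Since `φ ρ'` may be `∞`, a finite positive level below it is used for comparison with the
    -- real pairings.
    obtain ⟨c, hc0, hc⟩ := ENNReal.lt_iff_exists_nnreal_btwn.1 hpos
    have hc0' : (0 : ℝ) < c := by exact_mod_cast hc0
    filter_upwards [hi.eventually (gt_mem_nhds hc0')] with n hn
    rw [dist_zero_right]
    by_contra! hcon
    have h1 : φ ρ' ≤ φ ‖l - b n‖₊ := hφ (by
      rw [← NNReal.coe_le_coe, coe_nnnorm, norm_sub_rev]; exact hcon)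
    have h2 : ((c : ℝ≥0∞) : EReal) ≤ ((⟪l - b n, u - w n⟫_ℝ : ℝ) : EReal) :=
      (EReal.coe_ennreal_le_coe_ennreal_iff.2 (hc.le.trans h1)).trans (hle u hu (b n) _ (hw n))
    rw [← neg_sub (b n), ← neg_sub (w n), inner_neg_neg] at h2
    have h3 : (c : ℝ) ≤ ⟪b n - l, w n - u⟫_ℝ := by
      exact EReal.coe_le_coe_iff.1 h2
    linarith
  have := (hxb.add hb).add_const l
  simpa using this

end ForwardBackwardForward

/-! ### Componentwise arguments in Hilbert direct sums -/

theorem Approx.prod {E : Type u} [NormedAddCommGroup E] {F : Type v} [NormedAddCommGroup F]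
    {a b : ℕ → WithLp 2 (E × F)}
    (h₁ : Approx (fun n => (a n).fst) fun n => (b n).fst)
    (h₂ : Approx (fun n => (a n).snd) fun n => (b n).snd) : Approx a b := by
  refine Summable.of_nonneg_of_le (fun n => norm_nonneg _) (fun n => ?_) (Summable.add h₁ h₂)
  rw [WithLp.prod_norm_eq_of_L2]
  refine (Real.sqrt_le_sqrt (y := (‖(a n - b n).fst‖ + ‖(a n - b n).snd‖) ^ 2) ?_).trans ?_
  · nlinarith [norm_nonneg (a n - b n).fst, norm_nonneg (a n - b n).snd]
  · rw [Real.sqrt_sq (by positivity)]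
    rfl

theorem Approx.pi {ι : Type*} [Fintype ι] {E : ι → Type*} [∀ i, NormedAddCommGroup (E i)]
    {a b : ℕ → PiLp 2 E}
    (h : ∀ i, Approx (fun n => a n i) fun n => b n i) : Approx a b := by
  refine Summable.of_nonneg_of_le (fun n => norm_nonneg _) (fun n => ?_)
    (summable_sum (s := Finset.univ) fun i _ => h i)
  rw [PiLp.norm_eq_of_L2]
  refine (Real.sqrt_le_sqrt (Finset.sum_sq_le_sq_sum_of_nonneg fun i _ => norm_nonneg _)).trans ?_
  rw [Real.sqrt_sq (Finset.sum_nonneg fun i _ => norm_nonneg _)]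
  rfl

section Product

variable {E : Type u} [NormedAddCommGroup E] [InnerProductSpace ℝ E]
variable {F : Type v} [NormedAddCommGroup F] [InnerProductSpace ℝ F]

/-- The pairing on the direct sum is the sum of two nonnegative pairings, so each is squeezed by the
total. -/
theorem tendsto_inner_of_mem_prodOp {A : E → Set E} {B : F → Set F} (hA : IsMonotone A)
    (hB : IsMonotone B) {p w : ℕ → WithLp 2 (E × F)} {l u : WithLp 2 (E × F)}
    (hw : ∀ n, w n ∈ prodOp A B (p n)) (hu : u ∈ prodOp A B l)
    (h : Tendsto (fun n => ⟪p n - l, w n - u⟫_ℝ) atTop (𝓝 0)) :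
    Tendsto (fun n => ⟪(p n).fst - l.fst, (w n).fst - u.fst⟫_ℝ) atTop (𝓝 0) ∧
      Tendsto (fun n => ⟪(p n).snd - l.snd, (w n).snd - u.snd⟫_ℝ) atTop (𝓝 0) := by
  have h₁ : ∀ n, 0 ≤ ⟪(p n).fst - l.fst, (w n).fst - u.fst⟫_ℝ :=
    fun n => hA _ _ _ (hw n).1 _ hu.1
  have h₂ : ∀ n, 0 ≤ ⟪(p n).snd - l.snd, (w n).snd - u.snd⟫_ℝ :=
    fun n => hB _ _ _ (hw n).2 _ hu.2
  exact ⟨squeeze_zero h₁ (fun n => le_add_of_nonneg_right (h₂ n)) h,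
    squeeze_zero h₂ (fun n => le_add_of_nonneg_left (h₁ n)) h⟩

theorem tendsto_inner_of_mem_piOp {ι : Type*} [Fintype ι] {E : ι → Type*}
    [∀ i, NormedAddCommGroup (E i)] [∀ i, InnerProductSpace ℝ (E i)]
    {A : ∀ i, E i → Set (E i)} (hA : ∀ i, IsMonotone (A i)) {p w : ℕ → PiLp 2 E} {l u : PiLp 2 E}
    (hw : ∀ n, w n ∈ piOp A (p n)) (hu : u ∈ piOp A l)
    (h : Tendsto (fun n => ⟪p n - l, w n - u⟫_ℝ) atTop (𝓝 0)) (i : ι) :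
    Tendsto (fun n => ⟪p n i - l i, w n i - u i⟫_ℝ) atTop (𝓝 0) := by
  have h₀ : ∀ n j, 0 ≤ ⟪p n j - l j, w n j - u j⟫_ℝ := fun n j => hA j _ _ _ (hw n j) _ (hu j)
  exact squeeze_zero (fun n => h₀ n i) (fun n => Finset.single_le_sum
    (f := fun j => ⟪p n j - l j, w n j - u j⟫_ℝ) (fun j _ => h₀ n j) (Finset.mem_univ i)) h

/-- The operator `(p, q) ↦ (C p + T* q, -T p)`. -/
def skewExtension [CompleteSpace E] [CompleteSpace F] (C : E → E) (T : E →L[ℝ] F) :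
    WithLp 2 (E × F) → WithLp 2 (E × F) :=
  fun p => WithLp.toLp 2 (C p.fst + ContinuousLinearMap.adjoint T p.snd, -T p.fst)

variable [CompleteSpace E] [CompleteSpace F]

/-- The contributions of `T` and `-T` cancel by adjointness, so monotonicity depends on `C` alone.
-/
theorem inner_skewExtension_sub (C : E → E) (T : E →L[ℝ] F) (p q : WithLp 2 (E × F)) :
    ⟪p - q, skewExtension C T p - skewExtension C T q⟫_ℝ
      = ⟪p.fst - q.fst, C p.fst - C q.fst⟫_ℝ := by
  have e : ⟪p - q, skewExtension C T p - skewExtension C T q⟫_ℝ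
      = ⟪p.fst - q.fst, (C p.fst + ContinuousLinearMap.adjoint T p.snd)
          - (C q.fst + ContinuousLinearMap.adjoint T q.snd)⟫_ℝ
        + ⟪p.snd - q.snd, -T p.fst - -T q.fst⟫_ℝ := rfl
  have e₁ : (C p.fst + ContinuousLinearMap.adjoint T p.snd)
      - (C q.fst + ContinuousLinearMap.adjoint T q.snd)
      = (C p.fst - C q.fst) + ContinuousLinearMap.adjoint T (p.snd - q.snd) := by
    rw [map_sub]; abel
  have e₂ : -T p.fst - -T q.fst = -T (p.fst - q.fst) := by
    rw [map_sub]; abel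
  rw [e, e₁, e₂, inner_add_right, ContinuousLinearMap.adjoint_inner_right, inner_neg_right,
    real_inner_comm (T (p.fst - q.fst))]
  ring

/-- The skew block swaps the two orthogonal factors, acting by `T*` and `-T`, so its norm is at most
that of `T`; the part `(C, 0)` adds `μ`. -/
theorem norm_skewExtension_sub_le {C : E → E} {μ κ : ℝ} (hC : ∀ a b, ‖C a - C b‖ ≤ μ * ‖a - b‖)
    (hμ : 0 ≤ μ) {T : E →L[ℝ] F} (hT : ‖T‖ ≤ κ) (p q : WithLp 2 (E × F)) :
    ‖skewExtension C T p - skewExtension C T q‖ ≤ (μ + κ) * ‖p - q‖ := by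
  have hκ : 0 ≤ κ := (norm_nonneg _).trans hT
  have e : skewExtension C T p - skewExtension C T q
      = WithLp.toLp 2 (C p.fst - C q.fst, 0)
        + WithLp.toLp 2 (ContinuousLinearMap.adjoint T (p.snd - q.snd), -T (p.fst - q.fst)) := by
    rw [← WithLp.toLp_add, Prod.mk_add_mk, zero_add, map_sub, map_sub, skewExtension,
      skewExtension, ← WithLp.toLp_sub, Prod.mk_sub_mk]
    congr 2 <;> abel
  have hfst : ‖p.fst - q.fst‖ ≤ ‖p - q‖ := by
    rw [WithLp.prod_norm_eq_of_L2]
    refine Real.le_sqrt_of_sq_le ?_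
    have : 0 ≤ ‖(p - q).snd‖ ^ 2 := by positivity
    exact le_add_of_nonneg_right this
  have h₁ : ‖(WithLp.toLp 2 (C p.fst - C q.fst, 0) : WithLp 2 (E × F))‖ ≤ μ * ‖p - q‖ := by
    rw [WithLp.prod_norm_eq_of_L2]
    simp only [WithLp.toLp_fst, WithLp.toLp_snd, norm_zero, ne_eq, OfNat.ofNat_ne_zero,
      not_false_eq_true, zero_pow, add_zero, Real.sqrt_sq (norm_nonneg _)]
    exact (hC _ _).trans (mul_le_mul_of_nonneg_left hfst hμ)
  have h₂ : ‖(WithLp.toLp 2 (ContinuousLinearMap.adjoint T (p.snd - q.snd), -T (p.fst - q.fst)) :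
      WithLp 2 (E × F))‖ ≤ κ * ‖p - q‖ := by
    rw [WithLp.prod_norm_eq_of_L2]
    refine Real.sqrt_le_iff.2 ⟨by positivity, ?_⟩
    simp only [WithLp.toLp_fst, WithLp.toLp_snd, norm_neg]
    rw [mul_pow, WithLp.prod_norm_sq_eq_of_L2]
    have h₃ : ‖ContinuousLinearMap.adjoint T (p.snd - q.snd)‖ ^ 2
        ≤ κ ^ 2 * ‖(p - q).snd‖ ^ 2 := by
      rw [← mul_pow]
      refine pow_le_pow_left₀ (norm_nonneg _) (ContinuousLinearMap.le_of_opNorm_le _ ?_ _) 2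
      rwa [LinearIsometryEquiv.norm_map]
    have h₄ : ‖T (p.fst - q.fst)‖ ^ 2 ≤ κ ^ 2 * ‖(p - q).fst‖ ^ 2 := by
      rw [← mul_pow]
      exact pow_le_pow_left₀ (norm_nonneg _) (ContinuousLinearMap.le_of_opNorm_le _ hT _) 2
    linarith
  rw [e, add_mul]
  exact (norm_add_le _ _).trans (add_le_add h₁ h₂)

end Product

/-! ### Resolvent steps as graph inclusions -/

section Resolvent

variable {E : Type u} [NormedAddCommGroup E] [InnerProductSpace ℝ E]

theorem inv_smul_sub_add_mem_of_mem_opResolvent {A : E → Set E} {g : ℝ} (hg : g ≠ 0) {s z p : E}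
    (hp : p ∈ opResolvent (fun a => g • A a) (s + g • z)) : g⁻¹ • (s - p) + z ∈ A p := by
  obtain ⟨p', hp', _, ⟨a, ha, rfl⟩, h⟩ := hp
  obtain rfl : p' = p := hp'
  have e : g⁻¹ • (s - p') + z = a := by
    have h' : s - p' = g • (a - z) := by
      simp only at h
      rw [smul_sub, eq_sub_iff_add_eq, sub_add_eq_add_sub, ← h, add_sub_cancel_left]
    rw [h', inv_smul_smul₀ hg, sub_add_cancel]
  rwa [e]

/-- Moreau's decomposition: subtracting `g` times the resolvent of `g⁻¹ B` at `g⁻¹ s` is a backward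
step for `B⁻¹` with parameter `g`. -/
theorem mem_of_mem_sub_smul_opResolvent {B : E → Set E} {g : ℝ} (hg : g ≠ 0) {s p : E}
    (hp : p ∈ {s} - g • opResolvent (fun b => g⁻¹ • B b) (g⁻¹ • s)) : p ∈ B (g⁻¹ • (s - p)) := by
  obtain ⟨s', hs', _, ⟨b, ⟨b', hb', _, ⟨c, hc, rfl⟩, h⟩, rfl⟩, rfl⟩ := hp
  obtain rfl : s' = s := hs'
  obtain rfl : b' = b := hb'
  simp only at h ⊢
  rw [sub_sub_cancel, inv_smul_smul₀ hg]
  have e : s' - g • b' = c := by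
    rw [sub_eq_iff_eq_add', ← smul_inv_smul₀ hg c, ← smul_add, h, smul_inv_smul₀ hg]
  rwa [e]

end Resolvent

/-! ### The primal-dual operators -/

section PrimalDual

variable {r : ℕ} {H : Type u} {G : Fin r → Type v} {K : Fin r → Type w}
variable [NormedAddCommGroup H] [InnerProductSpace ℝ H]
variable [∀ k, NormedAddCommGroup (G k)] [∀ k, InnerProductSpace ℝ (G k)]
variable [∀ k, NormedAddCommGroup (K k)] [∀ k, InnerProductSpace ℝ (K k)]

/-- The space `H × Hʳ` of the variables `(x, y)`. -/
abbrev PrimalSpace (H : Type u) (r : ℕ) : Type u := WithLp 2 (H × PiLp 2 fun _ : Fin r => H)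

/-- The space `∏ G k × ∏ K k` of the variables `(v, w)`. -/
abbrev DualSpace (G : Fin r → Type v) (K : Fin r → Type w) : Type (max v w) :=
  WithLp 2 (PiLp 2 G × PiLp 2 K)

/-- The point `(x, y, v, w)` of the primal-dual space. -/
def primalDual (x : H) (y : Fin r → H) (v : ∀ k, G k) (w : ∀ k, K k) :
    WithLp 2 (PrimalSpace H r × DualSpace G K) :=
  WithLp.toLp 2 (WithLp.toLp 2 (x, WithLp.toLp 2 y),
    WithLp.toLp 2 (WithLp.toLp 2 v, WithLp.toLp 2 w))

/-- Scalar core of the bound on `coupling`. After expansion only the cross term `2 * x * W` is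
off-diagonal; Cauchy–Schwarz gives `W ^ 2 ≤ a * s * S`, and the arithmetic-geometric inequality
turns this into `s * x ^ 2 + a * S`, exactly the missing part of the product. -/
theorem sum_sq_add_sum_sq_le {r : ℕ} (ℓ m y : Fin r → ℝ) {s : ℝ} (hs : ∀ k, ℓ k ^ 2 + m k ^ 2 ≤ s)
    (hs₀ : 0 ≤ s) (x : ℝ) :
    ∑ k, (ℓ k * (x + y k)) ^ 2 + ∑ k, (m k * y k) ^ 2
      ≤ (∑ k, ℓ k ^ 2 + s) * (x ^ 2 + ∑ k, y k ^ 2) := by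
  set a := ∑ k, ℓ k ^ 2 with ha
  set S := ∑ k, y k ^ 2 with hS
  set W := ∑ k, ℓ k * (ℓ k * y k) with hW
  have ha₀ : 0 ≤ a := Finset.sum_nonneg fun k _ => sq_nonneg _
  have hS₀ : 0 ≤ S := Finset.sum_nonneg fun k _ => sq_nonneg _
  have h₁ : ∑ k, (ℓ k * (x + y k)) ^ 2 + ∑ k, (m k * y k) ^ 2
      = a * x ^ 2 + 2 * x * W + ∑ k, (ℓ k ^ 2 + m k ^ 2) * y k ^ 2 := by
    rw [ha, hW, Finset.sum_mul, Finset.mul_sum, ← Finset.sum_add_distrib, ← Finset.sum_add_distrib,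
      ← Finset.sum_add_distrib]
    exact Finset.sum_congr rfl fun k _ => by ring
  have h₂ : ∑ k, (ℓ k ^ 2 + m k ^ 2) * y k ^ 2 ≤ s * S := by
    rw [hS, Finset.mul_sum]
    exact Finset.sum_le_sum fun k _ => mul_le_mul_of_nonneg_right (hs k) (sq_nonneg _)
  have h₃ : W ^ 2 ≤ a * (s * S) := by
    refine (Finset.sum_mul_sq_le_sq_mul_sq _ _ _).trans (mul_le_mul_of_nonneg_left ?_ ha₀)
    rw [hS, Finset.mul_sum]
    refine Finset.sum_le_sum fun k _ => ?_
    rw [mul_pow]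
    exact mul_le_mul_of_nonneg_right (by linarith [hs k, sq_nonneg (m k)]) (sq_nonneg _)
  have h₄ : 2 * x * W ≤ s * x ^ 2 + a * S := by
    refine le_of_sq_le_sq ?_ (by positivity)
    have := mul_le_mul_of_nonneg_left h₃ (by positivity : 0 ≤ 4 * x ^ 2)
    nlinarith [sq_nonneg (s * x ^ 2 - a * S)]
  rw [h₁]
  linarith

theorem norm_coupling_le (L : ∀ k, H →L[ℝ] G k) (M : ∀ k, H →L[ℝ] K k) (p : PrimalSpace H r) :
    ‖(WithLp.toLp 2 (WithLp.toLp 2 fun k => L k (p.fst - p.snd k),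
      WithLp.toLp 2 fun k => M k (p.snd k)) : DualSpace G K)‖
      ≤ √(∑ k, ‖L k‖ ^ 2 + ⨆ k, (‖L k‖ ^ 2 + ‖M k‖ ^ 2)) * ‖p‖ := by
  have hs : ∀ k, ‖L k‖ ^ 2 + ‖M k‖ ^ 2 ≤ ⨆ k, (‖L k‖ ^ 2 + ‖M k‖ ^ 2) := fun k =>
    le_ciSup (f := fun k => ‖L k‖ ^ 2 + ‖M k‖ ^ 2) (Set.finite_range _).bddAbove k
  have hs₀ : 0 ≤ ⨆ k, (‖L k‖ ^ 2 + ‖M k‖ ^ 2) := Real.iSup_nonneg fun k => by positivity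
  rw [WithLp.prod_norm_eq_of_L2, WithLp.prod_norm_eq_of_L2, ← Real.sqrt_mul (by positivity)]
  refine Real.sqrt_le_sqrt ?_
  rw [PiLp.norm_sq_eq_of_L2, PiLp.norm_sq_eq_of_L2, PiLp.norm_sq_eq_of_L2]
  refine le_trans (add_le_add (Finset.sum_le_sum fun k _ => ?_) (Finset.sum_le_sum fun k _ => ?_))
    (sum_sq_add_sum_sq_le (fun k => ‖L k‖) (fun k => ‖M k‖) (fun k => ‖p.snd k‖) hs hs₀ ‖p.fst‖)
  · refine pow_le_pow_left₀ (norm_nonneg _) (((L k).le_opNorm _).trans ?_) 2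
    exact mul_le_mul_of_nonneg_left (norm_sub_le _ _) (norm_nonneg _)
  · exact pow_le_pow_left₀ (norm_nonneg _) ((M k).le_opNorm _) 2

/-- The operator `(x, y) ↦ ((Lₖ (x - yₖ))ₖ, (Mₖ yₖ)ₖ)`. -/
def coupling (L : ∀ k, H →L[ℝ] G k) (M : ∀ k, H →L[ℝ] K k) :
    PrimalSpace H r →L[ℝ] DualSpace G K :=
  LinearMap.mkContinuous
    { toFun := fun p => WithLp.toLp 2 (WithLp.toLp 2 fun k => L k (p.fst - p.snd k),
        WithLp.toLp 2 fun k => M k (p.snd k))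
      map_add' := fun p q => by
        rw [← WithLp.toLp_add, Prod.mk_add_mk, ← WithLp.toLp_add, ← WithLp.toLp_add]
        congr 3 <;> ext k <;> simp [add_sub_add_comm]
      map_smul' := fun c p => by
        rw [RingHom.id_apply, ← WithLp.toLp_smul, Prod.smul_mk, ← WithLp.toLp_smul,
          ← WithLp.toLp_smul]
        congr 3 <;> ext k <;> simp [smul_sub] }
    (√(∑ k, ‖L k‖ ^ 2 + ⨆ k, (‖L k‖ ^ 2 + ‖M k‖ ^ 2))) (norm_coupling_le L M)

theorem coupling_apply (L : ∀ k, H →L[ℝ] G k) (M : ∀ k, H →L[ℝ] K k) (p : PrimalSpace H r) :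
    coupling L M p = WithLp.toLp 2 (WithLp.toLp 2 fun k => L k (p.fst - p.snd k),
      WithLp.toLp 2 fun k => M k (p.snd k)) := rfl

theorem opNorm_coupling_le (L : ∀ k, H →L[ℝ] G k) (M : ∀ k, H →L[ℝ] K k) :
    ‖coupling L M‖ ≤ √(∑ k, ‖L k‖ ^ 2 + ⨆ k, (‖L k‖ ^ 2 + ‖M k‖ ^ 2)) :=
  LinearMap.mkContinuous_norm_le _ (Real.sqrt_nonneg _) _

/-- The set-valued part of the primal-dual inclusion. -/
def backwardOp (z : H) (A : H → Set H) (B : ∀ k, G k → Set (G k)) (D : ∀ k, K k → Set (K k)) :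
    WithLp 2 (PrimalSpace H r × DualSpace G K) →
      Set (WithLp 2 (PrimalSpace H r × DualSpace G K)) :=
  prodOp (prodOp (fun x => {u | u + z ∈ A x}) (piOp fun _ => single fun _ => 0))
    (prodOp (piOp fun k => opInv (B k)) (piOp fun k => opInv (D k)))

theorem isMaximallyMonotone_single_zero :
    IsMaximallyMonotone (single fun _ : H => (0 : H)) :=
  isMaximallyMonotone_single (by rintro x y _ rfl _ rfl; simp) continuous_const

theorem isMaximallyMonotone_backwardOp (z : H) {A : H → Set H} (hA : IsMaximallyMonotone A)
    {B : ∀ k, G k → Set (G k)} (hB : ∀ k, IsMaximallyMonotone (B k))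
    {D : ∀ k, K k → Set (K k)} (hD : ∀ k, IsMaximallyMonotone (D k)) :
    IsMaximallyMonotone (backwardOp z A B D) :=
  ((hA.sub_const z).prodOp (.piOp fun _ => isMaximallyMonotone_single_zero)).prodOp
    ((IsMaximallyMonotone.piOp fun k => (hB k).opInv).prodOp
      (IsMaximallyMonotone.piOp fun k => (hD k).opInv))

variable [CompleteSpace H] [∀ k, CompleteSpace (G k)] [∀ k, CompleteSpace (K k)]

theorem adjoint_coupling_apply (L : ∀ k, H →L[ℝ] G k) (M : ∀ k, H →L[ℝ] K k)
    (q : DualSpace G K) :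
    ContinuousLinearMap.adjoint (coupling L M) q
      = WithLp.toLp 2 (∑ k, ContinuousLinearMap.adjoint (L k) (q.fst k),
          WithLp.toLp 2 fun k => ContinuousLinearMap.adjoint (M k) (q.snd k)
            - ContinuousLinearMap.adjoint (L k) (q.fst k)) := by
  refine ext_inner_left ℝ fun p => ?_
  rw [ContinuousLinearMap.adjoint_inner_right, coupling_apply]
  simp only [WithLp.prod_inner_apply, PiLp.inner_apply, inner_sum, map_sub, inner_sub_left,
    inner_sub_right, ContinuousLinearMap.adjoint_inner_right, Finset.sum_sub_distrib]
  change ∑ k, ⟪L k p.fst, q.fst k⟫_ℝ - ∑ k, ⟪L k (p.snd k), q.fst k⟫_ℝ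
      + ∑ k, ⟪M k (p.snd k), q.snd k⟫_ℝ = ∑ k, ⟪L k p.fst, q.fst k⟫_ℝ
      + (∑ k, ⟪M k (p.snd k), q.snd k⟫_ℝ - ∑ k, ⟪L k (p.snd k), q.fst k⟫_ℝ)
  ring

/-- The single-valued part of the primal-dual inclusion. -/
def forwardOp (C : H → H) (L : ∀ k, H →L[ℝ] G k) (M : ∀ k, H →L[ℝ] K k) :
    WithLp 2 (PrimalSpace H r × DualSpace G K) → WithLp 2 (PrimalSpace H r × DualSpace G K) :=
  skewExtension (fun p => WithLp.toLp 2 (C p.fst, 0)) (coupling L M)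

theorem forwardOp_primalDual (C : H → H) (L : ∀ k, H →L[ℝ] G k) (M : ∀ k, H →L[ℝ] K k)
    (x : H) (y : Fin r → H) (v : ∀ k, G k) (w : ∀ k, K k) :
    forwardOp C L M (primalDual x y v w)
      = primalDual (C x + ∑ k, ContinuousLinearMap.adjoint (L k) (v k))
          (fun k => ContinuousLinearMap.adjoint (M k) (w k)
            - ContinuousLinearMap.adjoint (L k) (v k))
          (fun k => -L k (x - y k)) (fun k => -M k (y k)) := by
  rw [forwardOp, skewExtension, adjoint_coupling_apply, coupling_apply, primalDual, primalDual]
  simp only [WithLp.toLp_fst, WithLp.toLp_snd]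
  congr 2
  rw [← WithLp.toLp_add, Prod.mk_add_mk, zero_add]

theorem inner_forwardOp_sub (C : H → H) (L : ∀ k, H →L[ℝ] G k) (M : ∀ k, H →L[ℝ] K k)
    (p q : WithLp 2 (PrimalSpace H r × DualSpace G K)) :
    ⟪p - q, forwardOp C L M p - forwardOp C L M q⟫_ℝ
      = ⟪p.fst.fst - q.fst.fst, C p.fst.fst - C q.fst.fst⟫_ℝ := by
  rw [forwardOp, inner_skewExtension_sub, WithLp.prod_inner_apply]
  change _ + ⟪(p.fst - q.fst).snd, (0 : PiLp 2 fun _ : Fin r => H) - 0⟫_ℝ = _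
  rw [sub_zero, inner_zero_right, add_zero]
  rfl

theorem isMonotone_forwardOp {C : H → H} (hC : IsMonotone (single C)) (L : ∀ k, H →L[ℝ] G k)
    (M : ∀ k, H →L[ℝ] K k) : IsMonotone (single (forwardOp C L M)) := by
  rintro p q _ rfl _ rfl
  rw [inner_forwardOp_sub]
  exact hC _ _ _ rfl _ rfl

theorem norm_forwardOp_sub_le {C : H → H} {μ : ℝ≥0} (hC : LipschitzWith μ C)
    (L : ∀ k, H →L[ℝ] G k) (M : ∀ k, H →L[ℝ] K k)
    (p q : WithLp 2 (PrimalSpace H r × DualSpace G K)) :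
    ‖forwardOp C L M p - forwardOp C L M q‖ ≤ beta μ L M * ‖p - q‖ := by
  refine norm_skewExtension_sub_le (fun a b => ?_) μ.2 (opNorm_coupling_le L M) p q
  rw [← WithLp.toLp_sub, Prod.mk_sub_mk, sub_zero, WithLp.prod_norm_eq_of_L2]
  simp only [WithLp.toLp_fst, WithLp.toLp_snd, norm_zero, ne_eq, OfNat.ofNat_ne_zero,
    not_false_eq_true, zero_pow, add_zero, Real.sqrt_sq (norm_nonneg _)]
  refine (hC.norm_sub_le _ _).trans (mul_le_mul_of_nonneg_left ?_ μ.2)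
  rw [WithLp.prod_norm_eq_of_L2]
  refine Real.le_sqrt_of_sq_le ?_
  have : 0 ≤ ‖(a - b).snd‖ ^ 2 := by positivity
  exact le_add_of_nonneg_right this

theorem neg_forwardOp_mem_backwardOp_iff {z : H} {A : H → Set H} {C : H → H}
    {B : ∀ k, G k → Set (G k)} {D : ∀ k, K k → Set (K k)}
    {L : ∀ k, H →L[ℝ] G k} {M : ∀ k, H →L[ℝ] K k}
    {x : H} {y : Fin r → H} {v : ∀ k, G k} {w : ∀ k, K k} :
    -forwardOp C L M (primalDual x y v w) ∈ backwardOp z A B D (primalDual x y v w) ↔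
      z - C x - ∑ k, ContinuousLinearMap.adjoint (L k) (v k) ∈ A x ∧
      (∀ k, ContinuousLinearMap.adjoint (L k) (v k) = ContinuousLinearMap.adjoint (M k) (w k)) ∧
      (∀ k, v k ∈ B k (L k (x - y k))) ∧ ∀ k, w k ∈ D k (M k (y k)) := by
  rw [forwardOp_primalDual]
  have e : -(C x + ∑ k, ContinuousLinearMap.adjoint (L k) (v k)) + z
      = z - C x - ∑ k, ContinuousLinearMap.adjoint (L k) (v k) := by abel
  have e₁ : ∀ k, -(ContinuousLinearMap.adjoint (M k) (w k)
      - ContinuousLinearMap.adjoint (L k) (v k)) = 0 ↔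
      ContinuousLinearMap.adjoint (L k) (v k) = ContinuousLinearMap.adjoint (M k) (w k) :=
    fun k => by rw [neg_sub, sub_eq_zero]
  -- In the dual slots `P` consists of inverses, so membership there unfolds definitionally to
  -- membership in `B k` and `D k`.
  have key : -primalDual (C x + ∑ k, ContinuousLinearMap.adjoint (L k) (v k))
      (fun k => ContinuousLinearMap.adjoint (M k) (w k)
        - ContinuousLinearMap.adjoint (L k) (v k))
      (fun k => -L k (x - y k)) (fun k => -M k (y k)) ∈ backwardOp z A B D (primalDual x y v w) ↔
      (-(C x + ∑ k, ContinuousLinearMap.adjoint (L k) (v k)) + z ∈ A x ∧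
        ∀ k, -(ContinuousLinearMap.adjoint (M k) (w k)
          - ContinuousLinearMap.adjoint (L k) (v k)) = 0) ∧
      (∀ k, v k ∈ B k (- -L k (x - y k))) ∧ ∀ k, w k ∈ D k (- -M k (y k)) := Iff.rfl
  rw [key, e]
  simp only [e₁, neg_neg, and_assoc]

/-- An element of the `k`-th parallel sum at `x` is a common value `L k* v = M k* w` taken at two
points with sum `x`; `y k` is the second point. -/
theorem isPrimalSolution_iff {z : H} {A : H → Set H} {C : H → H}
    {B : ∀ k, G k → Set (G k)} {D : ∀ k, K k → Set (K k)}
    {L : ∀ k, H →L[ℝ] G k} {M : ∀ k, H →L[ℝ] K k} {x : H} :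
    IsPrimalSolution z A C B D L M x ↔ ∃ (y : Fin r → H) (v : ∀ k, G k) (w : ∀ k, K k),
      -forwardOp C L M (primalDual x y v w) ∈ backwardOp z A B D (primalDual x y v w) := by
  simp only [neg_forwardOp_mem_backwardOp_iff]
  constructor
  · rintro ⟨_, ⟨a, ha, t, ht, rfl⟩, _, rfl, h⟩
    obtain ⟨g, hg, rfl⟩ := (Set.mem_finsetSum _ _ _).1 ht
    have hg' : ∀ k, ∃ (y : H) (v : G k) (w : K k), ContinuousLinearMap.adjoint (L k) v = g k ∧
        ContinuousLinearMap.adjoint (M k) w = g k ∧ v ∈ B k (L k (x - y)) ∧ w ∈ D k (M k y) := by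
      intro k
      obtain ⟨b, ⟨v, hv, hvg⟩, y, ⟨w, hw, hwg⟩, hby⟩ := hg (Finset.mem_univ k)
      refine ⟨y, v, w, hvg, hwg, ?_, hw⟩
      rwa [← eq_sub_of_add_eq hby]
    choose y v w hv hw hvB hwD using hg'
    refine ⟨y, v, w, ?_, fun k => (hv k).trans (hw k).symm, hvB, hwD⟩
    have e : z - C x - ∑ k, ContinuousLinearMap.adjoint (L k) (v k) = a := by
      have h' : a + ∑ k, g k + C x = z := h
      simp only [hv]
      rw [← h']
      abel
    rwa [e]
  · rintro ⟨y, v, w, ha, hvw, hv, hw⟩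
    refine ⟨_, ⟨_, ha, ∑ k, ContinuousLinearMap.adjoint (L k) (v k), ?_, rfl⟩, C x, rfl, ?_⟩
    · refine (Set.mem_finsetSum _ _ _).2 ⟨_, fun {k} _ => ?_, rfl⟩
      exact ⟨x - y k, ⟨v k, hv k, rfl⟩, y k, ⟨w k, hw k, (hvw k).symm⟩, sub_add_cancel _ _⟩
    · simp only
      abel

/-- The three summands are `-L k x`, `L k (x - y k)` and `L k (y k)`. The last is admissible because
`M k* ▷ (D k)⁻¹` is the inverse of `M k* ∘ D k ∘ M k`, up to the double adjoint. -/
theorem isDualSolution_of_neg_forwardOp_mem {z : H} {A : H → Set H} {C : H → H}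
    {B : ∀ k, G k → Set (G k)} {D : ∀ k, K k → Set (K k)}
    {L : ∀ k, H →L[ℝ] G k} {M : ∀ k, H →L[ℝ] K k} {x : H}
    {y : Fin r → H} {v : ∀ k, G k} {w : ∀ k, K k}
    (h : -forwardOp C L M (primalDual x y v w) ∈ backwardOp z A B D (primalDual x y v w)) :
    IsDualSolution z A C B D L M v := by
  obtain ⟨ha, hvw, hv, hw⟩ := neg_forwardOp_mem_backwardOp_iff.1 h
  intro k
  refine ⟨_, ⟨-L k x, ?_, L k (x - y k), hv k, rfl⟩, L k (y k), ⟨y k, ?_, rfl⟩, ?_⟩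
  · rw [Set.mem_neg, neg_neg]
    refine ⟨x, ⟨_, ha, C x, rfl, ?_⟩, rfl⟩
    simp only
    abel
  · refine ⟨w k, ?_, (hvw k).symm⟩
    have := hw k
    rwa [← ContinuousLinearMap.adjoint_adjoint (M k)] at this
  · simp only [map_sub]
    abel

end PrimalDual

end MonotoneSplitting

end

/-! ### The algorithm as a forward-backward-forward iteration -/

theorem theorem3p2
    {H : Type*} [NormedAddCommGroup H] [InnerProductSpace ℝ H] [CompleteSpace H]
    (r : ℕ) (hr : 0 < r)
    {G : Fin r → Type*} [∀ k, NormedAddCommGroup (G k)] [∀ k, InnerProductSpace ℝ (G k)]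
    [∀ k, CompleteSpace (G k)]
    {K : Fin r → Type*} [∀ k, NormedAddCommGroup (K k)] [∀ k, InnerProductSpace ℝ (K k)]
    [∀ k, CompleteSpace (K k)]
    -- the primal-dual problem
    (z : H)
    (A : H → Set H) (hA : MonotoneSplitting.IsMaximallyMonotone A)
    (C : H → H) (hC : MonotoneSplitting.IsMonotone (MonotoneSplitting.single C))
    (μ : ℝ≥0) (hCμ : LipschitzWith μ C)
    (B : ∀ k, G k → Set (G k)) (hB : ∀ k, MonotoneSplitting.IsMaximallyMonotone (B k))
    (D : ∀ k, K k → Set (K k)) (hD : ∀ k, MonotoneSplitting.IsMaximallyMonotone (D k))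
    (L : ∀ k, H →L[ℝ] G k) (M : ∀ k, H →L[ℝ] K k)
    (hβ : 0 < MonotoneSplitting.beta μ L M)
    (hsol : ∃ x, MonotoneSplitting.IsPrimalSolution z A C B D L M x)
    -- the parameters
    (ε : ℝ) (hε : ε ∈ Set.Ioo 0 (1 / (MonotoneSplitting.beta μ L M + 1)))
    (γ : ℕ → ℝ) (hγ : ∀ n, γ n ∈ Set.Icc ε ((1 - ε) / MonotoneSplitting.beta μ L M))
    -- the sequences: `s₁`, `p₁`, `q₁` carry the index `(1,1,n)`, `p₁'`, `q₁'` the index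
    -- `(1,k+1,n)`, `s₂`, `p₂`, `q₂` the index `(2,k,n)`, `s₂'`, `p₂'`, `q₂'` the index `(2,k+r,n)`
    (x s₁ p₁ q₁ : ℕ → H)
    (y p₁' q₁' : Fin r → ℕ → H)
    (v s₂ p₂ q₂ : ∀ k, ℕ → G k)
    (w s₂' p₂' q₂' : ∀ k, ℕ → K k)
    -- the iteration
    (hs₁ : MonotoneSplitting.Approx s₁ (fun n => x n - γ n • (C (x n)
      + ∑ k, ContinuousLinearMap.adjoint (L k) (v k n))))
    (hp₁ : MonotoneSplitting.ApproxValue p₁ (fun n =>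
      MonotoneSplitting.opResolvent (fun a => γ n • A a) (s₁ n + γ n • z)))
    (hp₁' : ∀ k, MonotoneSplitting.Approx (p₁' k) (fun n => y k n
      + γ n • (ContinuousLinearMap.adjoint (L k) (v k n)
        - ContinuousLinearMap.adjoint (M k) (w k n))))
    (hs₂ : ∀ k, MonotoneSplitting.Approx (s₂ k) (fun n => v k n + γ n • L k (x n - y k n)))
    (hp₂ : ∀ k, MonotoneSplitting.ApproxValue (p₂ k) (fun n => {s₂ k n}
      - γ n • MonotoneSplitting.opResolvent (fun b => (γ n)⁻¹ • B k b) ((γ n)⁻¹ • s₂ k n)))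
    (hq₂ : ∀ k, MonotoneSplitting.Approx (q₂ k) (fun n => p₂ k n
      + γ n • L k (p₁ n - p₁' k n)))
    (hv : ∀ k n, v k (n + 1) = v k n - s₂ k n + q₂ k n)
    (hs₂' : ∀ k, MonotoneSplitting.Approx (s₂' k) (fun n => w k n + γ n • M k (y k n)))
    (hp₂' : ∀ k, MonotoneSplitting.ApproxValue (p₂' k) (fun n => {s₂' k n}
      - γ n • MonotoneSplitting.opResolvent (fun d => (γ n)⁻¹ • D k d) ((γ n)⁻¹ • s₂' k n)))
    (hq₁' : ∀ k, MonotoneSplitting.Approx (q₁' k) (fun n => p₁' k n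
      + γ n • (ContinuousLinearMap.adjoint (L k) (p₂ k n)
        - ContinuousLinearMap.adjoint (M k) (p₂' k n))))
    (hq₂' : ∀ k, MonotoneSplitting.Approx (q₂' k) (fun n => p₂' k n + γ n • M k (p₁' k n)))
    (hw : ∀ k n, w k (n + 1) = w k n - s₂' k n + q₂' k n)
    (hq₁ : MonotoneSplitting.Approx q₁ (fun n => p₁ n - γ n • (C (p₁ n)
      + ∑ k, ContinuousLinearMap.adjoint (L k) (p₂ k n))))
    (hx : ∀ n, x (n + 1) = x n - s₁ n + q₁ n)
    (hy : ∀ k n, y k (n + 1) = y k n - p₁' k n + q₁' k n) :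
    ∃ (xbar : H) (vbar : ∀ k, G k),
      MonotoneSplitting.IsPrimalSolution z A C B D L M xbar ∧
      MonotoneSplitting.IsDualSolution z A C B D L M vbar ∧
      (MonotoneSplitting.TendstoWeakly x xbar ∧
        ∀ k, MonotoneSplitting.TendstoWeakly (v k) (vbar k)) ∧
      ((MonotoneSplitting.IsUniformlyMonotoneAt A xbar ∨
          MonotoneSplitting.IsUniformlyMonotoneAt (MonotoneSplitting.single C) xbar) →
        Tendsto x atTop (𝓝 xbar)) ∧
      (∀ k, MonotoneSplitting.IsUniformlyMonotoneAt
          (MonotoneSplitting.opInv (B k)) (vbar k) →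
        Tendsto (v k) atTop (𝓝 (vbar k))) := by
  obtain ⟨b₁, hb₁, hpb₁⟩ := hp₁
  choose b₂ hb₂ hpb₂ using hp₂
  choose b₃ hb₃ hpb₃ using hp₂'
  have hβ1 : 0 < MonotoneSplitting.beta μ L M + 1 := by linarith
  have hε1 : ε < 1 := hε.2.trans_le ((div_le_one hβ1).2 (by linarith))
  have hγ0 : ∀ n, γ n ≠ 0 := fun n => (hε.1.trans_le (hγ n).1).ne'
  let Q := MonotoneSplitting.forwardOp C L M
  let P := MonotoneSplitting.backwardOp (r := r) z A B D
  let X := fun n => MonotoneSplitting.primalDual (x n) (fun k => y k n)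
    (fun k => v k n) (fun k => w k n)
  -- On the `y` coordinates `P` is zero and its resolvent is the identity, so `p₁'` serves as
  -- forward point, resolvent point and exact resolvent value at once.
  let S := fun n => MonotoneSplitting.primalDual (s₁ n) (fun k => p₁' k n)
    (fun k => s₂ k n) (fun k => s₂' k n)
  let R := fun n => MonotoneSplitting.primalDual (p₁ n) (fun k => p₁' k n)
    (fun k => p₂ k n) (fun k => p₂' k n)
  let b := fun n => MonotoneSplitting.primalDual (b₁ n) (fun k => p₁' k n)
    (fun k => b₂ k n) (fun k => b₃ k n)
  let T := fun n => MonotoneSplitting.primalDual (q₁ n) (fun k => q₁' k n)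
    (fun k => q₂ k n) (fun k => q₂' k n)
  have happrox : ∀ a a' : ℕ → WithLp 2 (MonotoneSplitting.PrimalSpace H r ×
      MonotoneSplitting.DualSpace G K),
      MonotoneSplitting.Approx (fun n => (a n).fst.fst) (fun n => (a' n).fst.fst) →
      (∀ k, MonotoneSplitting.Approx (fun n => (a n).fst.snd k) fun n => (a' n).fst.snd k) →
      (∀ k, MonotoneSplitting.Approx (fun n => (a n).snd.fst k) fun n => (a' n).snd.fst k) →
      (∀ k, MonotoneSplitting.Approx (fun n => (a n).snd.snd k) fun n => (a' n).snd.snd k) →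
      MonotoneSplitting.Approx a a' := fun a a' h₁ h₂ h₃ h₄ =>
    .prod (.prod h₁ (.pi h₂)) (.prod (.pi h₃) (.pi h₄))
  have hQ : ∀ (x : H) (y : Fin r → H) (v : ∀ k, G k) (w : ∀ k, K k),
      Q (MonotoneSplitting.primalDual x y v w) = _ :=
    MonotoneSplitting.forwardOp_primalDual C L M
  have hS : MonotoneSplitting.Approx S fun n => X n - γ n • Q (X n) := by
    simp only [X, hQ]
    refine happrox _ _ hs₁ (fun k => ?_) (fun k => ?_) fun k => ?_
    · refine (hp₁' k).congr fun n => ?_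
      change _ = ‖p₁' k n - (y k n - γ n • (ContinuousLinearMap.adjoint (M k) (w k n)
        - ContinuousLinearMap.adjoint (L k) (v k n)))‖
      congr 2
      module
    · refine (hs₂ k).congr fun n => ?_
      change _ = ‖s₂ k n - (v k n - γ n • -L k (x n - y k n))‖
      rw [smul_neg, sub_neg_eq_add]
    · refine (hs₂' k).congr fun n => ?_
      change _ = ‖s₂' k n - (w k n - γ n • -M k (y k n))‖
      rw [smul_neg, sub_neg_eq_add]
  have hT : MonotoneSplitting.Approx T fun n => R n - γ n • Q (R n) := by
    simp only [R, hQ]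
    refine happrox _ _ hq₁ (fun k => ?_) (fun k => ?_) fun k => ?_
    · refine (hq₁' k).congr fun n => ?_
      change _ = ‖q₁' k n - (p₁' k n - γ n • (ContinuousLinearMap.adjoint (M k) (p₂' k n)
        - ContinuousLinearMap.adjoint (L k) (p₂ k n)))‖
      congr 2
      module
    · refine (hq₂ k).congr fun n => ?_
      change _ = ‖q₂ k n - (p₂ k n - γ n • -L k (p₁ n - p₁' k n))‖
      rw [smul_neg, sub_neg_eq_add]
    · refine (hq₂' k).congr fun n => ?_
      change _ = ‖q₂' k n - (p₂' k n - γ n • -M k (p₁' k n))‖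
      rw [smul_neg, sub_neg_eq_add]
  have hR : MonotoneSplitting.Approx R b := by
    refine happrox _ _ hpb₁ (fun k => ?_) hpb₂ hpb₃
    refine summable_zero.congr fun n => ?_
    change 0 = ‖p₁' k n - p₁' k n‖
    rw [sub_self, norm_zero]
  have hmem : ∀ n, (γ n)⁻¹ • (S n - b n) ∈ P (b n) := fun n => by
    refine ⟨⟨MonotoneSplitting.inv_smul_sub_add_mem_of_mem_opResolvent (hγ0 n) (hb₁ n), fun k => ?_⟩,
      fun k => MonotoneSplitting.mem_of_mem_sub_smul_opResolvent (hγ0 n) (hb₂ k n),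
      fun k => MonotoneSplitting.mem_of_mem_sub_smul_opResolvent (hγ0 n) (hb₃ k n)⟩
    change (γ n)⁻¹ • (p₁' k n - p₁' k n) = 0
    rw [sub_self, smul_zero]
  have hX : ∀ n, X (n + 1) = X n - S n + T n := fun n => by
    simp only [X, hx, hy, hv, hw]
    rfl
  have hPmax := MonotoneSplitting.isMaximallyMonotone_backwardOp (r := r) z hA hB hD
  have hQmono := MonotoneSplitting.isMonotone_forwardOp hC L M
  have hzero : ∃ l, -Q l ∈ P l := by
    obtain ⟨x₀, hx₀⟩ := hsol
    obtain ⟨y₀, v₀, w₀, h₀⟩ := MonotoneSplitting.isPrimalSolution_iff.1 hx₀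
    exact ⟨_, h₀⟩
  obtain ⟨l, hl, hweak, hXb, hPi, hQi⟩ :=
    MonotoneSplitting.exists_weakLim_forwardBackwardForward hPmax hQmono hβ
      (MonotoneSplitting.norm_forwardOp_sub_le hCμ L M) hε.1 hε1 hγ hzero hS hR hmem hT hX
  have hl' : -Q (MonotoneSplitting.primalDual l.fst.fst l.fst.snd l.snd.fst l.snd.snd) ∈
    P (MonotoneSplitting.primalDual l.fst.fst l.fst.snd l.snd.fst l.snd.snd) := hl
  have hPi' : Tendsto (fun n => ⟪b n - l, (γ n)⁻¹ • (S n - b n) - -Q l⟫_ℝ) atTop (𝓝 0) := by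
    simpa only [sub_neg_eq_add] using hPi
  obtain ⟨hi₁, hi₂⟩ := MonotoneSplitting.tendsto_inner_of_mem_prodOp
    (((hA.sub_const z).prodOp (.piOp fun _ =>
      MonotoneSplitting.isMaximallyMonotone_single_zero)).isMonotone)
    (((MonotoneSplitting.IsMaximallyMonotone.piOp fun k => (hB k).opInv).prodOp
      (MonotoneSplitting.IsMaximallyMonotone.piOp fun k => (hD k).opInv)).isMonotone) hmem hl hPi'
  let πx := (WithLp.fstL 2 ℝ H (PiLp 2 fun _ : Fin r => H)).comp
    (WithLp.fstL 2 ℝ (MonotoneSplitting.PrimalSpace H r) (MonotoneSplitting.DualSpace G K))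
  let πv := fun k => (PiLp.proj 2 G k : _ →L[ℝ] G k).comp
    ((WithLp.fstL 2 ℝ (PiLp 2 G) (PiLp 2 K)).comp
      (WithLp.sndL 2 ℝ (MonotoneSplitting.PrimalSpace H r) (MonotoneSplitting.DualSpace G K)))
  have hxb : Tendsto (fun n => x n - b₁ n) atTop (𝓝 0) := by
    have := (πx.continuous.tendsto 0).comp hXb
    rwa [map_zero] at this
  have hvb : ∀ k, Tendsto (fun n => v k n - b₂ k n) atTop (𝓝 0) := fun k => by
    have := ((πv k).continuous.tendsto 0).comp hXb
    rwa [map_zero] at this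
  refine ⟨l.fst.fst, l.snd.fst, MonotoneSplitting.isPrimalSolution_iff.2 ⟨_, _, _, hl'⟩,
    MonotoneSplitting.isDualSolution_of_neg_forwardOp_mem hl', ⟨?_, fun k => ?_⟩, ?_, fun k hk => ?_⟩
  · exact MonotoneSplitting.tendstoWeakly_of_weakLim (hweak.map πx)
  · exact MonotoneSplitting.tendstoWeakly_of_weakLim (hweak.map (πv k))
  · rintro (hA' | hC')
    · have := (MonotoneSplitting.tendsto_inner_of_mem_prodOp (hA.sub_const z).isMonotone
        (MonotoneSplitting.IsMaximallyMonotone.piOp fun _ =>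
          MonotoneSplitting.isMaximallyMonotone_single_zero).isMonotone
        (fun n => (hmem n).1) hl.1 hi₁).1
      refine hA'.tendsto hl.1.1 (fun n => (hmem n).1.1) ?_ hxb
      simpa only [add_sub_add_right_eq_sub] using this
    -- The skew part drops out of the pairing `hQi`, leaving exactly the pairing for `C`.
    · refine hC'.tendsto (u := C l.fst.fst) (w := fun n => C (b₁ n)) rfl (fun n => rfl) ?_ hxb
      refine hQi.congr fun n => ?_
      exact MonotoneSplitting.inner_forwardOp_sub C L M _ _
  · have := MonotoneSplitting.tendsto_inner_of_mem_piOp (fun k => (hB k).opInv.isMonotone)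
      (fun n => (hmem n).2.1) hl.2.1 (MonotoneSplitting.tendsto_inner_of_mem_prodOp
        (MonotoneSplitting.IsMaximallyMonotone.piOp fun k => (hB k).opInv).isMonotone
        (MonotoneSplitting.IsMaximallyMonotone.piOp fun k => (hD k).opInv).isMonotone
        (fun n => (hmem n).2) hl.2 hi₂).1 k
    exact hk.tendsto (hl.2.1 k) (fun n => (hmem n).2.1 k) this (hvb k)
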